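/- Let $0\le d\le n$ and $\alpha\in\mathbb{R}\setminus\{0\}$. Consider $\mathrm{SO}(n)\subset\mathbb{R}^{n\times n}$, with tangent space $T_X\mathrm{SO}(n)=\{\xi : X^{-1}\xi\in\mathfrak{so}(n)\}$ at $X$, where $\mathfrak{so}(n)$ is the space of antisymmetric matrices. For $\omega\in\mathbb{R}^{n\times n}$ let $\omega_{\mathfrak a}$ be the matrix whose top left $d\times d$ block is the antisymmetric part $\frac12(W-W^{\mathsf T})$ of the corresponding block $W$ of $\omega$ and whose other entries vanish. For $\beta_0,\beta_1\in\mathbb{R}$ let $$\langle \mathtt g,\mathtt h\rangle_{\beta_0,\beta_1}=\beta_0\bigl(\mathrm{Tr}(\mathtt h\mathtt g)-\mathrm{Tr}(\mathtt h_{\mathfrak a}\mathtt g_{\mathfrak a})\bigr)-\beta_1\mathrm{Tr}(\mathtt h_{\mathfrak a}\mathtt g_{\mathfrak a}),$$ and equip $\mathrm{SO}(n)$ with the left-invariant metric $\langle\xi,\eta\rangle_X=\langle X^{-1}\xi,X^{-1}\eta\rangle_{\beta_0,\beta_1}$ with $\beta_0=-\frac12$, $\beta_1=\alpha$. A Christoffel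 function $\Gamma(X;\xi,\eta)$ of the Levi-Civita connection is a function, bilinear in $\xi,\eta\in T_X\mathrm{SO}(n)$ for each $X\in\mathrm{SO}(n)$, such that $\nabla_{\mathtt Y}\mathtt Z=\mathrm D_{\mathtt Y}\mathtt Z+\Gamma(\mathtt Y,\mathtt Z)$ is a smooth vector field on $\mathrm{SO}(n)$ for all smooth vector fields $\mathtt Y,\mathtt Z$, with $\Gamma(X;\xi,\eta)=\Gamma(X;\eta,\xi)$ and $\mathrm D_{\mathtt Y}\langle\mathtt Z,\mathtt Z\rangle=2\langle\mathtt Z,\nabla_{\mathtt Y}\mathtt Z\rangle$. Such a $\Gamma$ exists and is unique. Moreover, let $X\in\mathrm{SO}(n)$ and let $$\xi=X\begin{bmatrix}A_\xi&-B_\xi^{\mathsf T}\\B_\xi&C_\xi\end{bmatrix},\qquad \eta=X\begin{bmatrix}A_\eta&-B_\eta^{\mathsf T}\\B_\eta&C_\eta\end{bmatrix}$$ be tangent vectors at $X$, where $A_\xi,A_\eta\in\mathfrak{so}(d)$, $C_\xi,C_\eta\in\mathfrak{so}(n-d)$ and $B_\xi,B_\eta\in\mathbb{R}^{(n-d)\times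 d}$. Then the following hold. 1. The metric is $$\langle\xi,\eta\rangle_X=\tfrac12\mathrm{Tr}\,\xi^{\mathsf T}\eta+(\alpha-\tfrac12)\mathrm{Tr}\bigl((\xi^{\mathsf T}X)_{\mathfrak a}(X^{\mathsf T}\eta)_{\mathfrak a}\bigr)=\tfrac12\mathrm{Tr}\,\xi^{\mathsf T}\eta+(\alpha-\tfrac12)\mathrm{Tr}\,A_\xi^{\mathsf T}A_\eta .$$ 2. The Christoffel function is $$\begin{aligned}\Gamma(\xi,\eta)&=\tfrac12X(\xi^{\mathsf T}\eta+\eta^{\mathsf T}\xi)+\tfrac{1-2\alpha}{2}X\bigl([(X^{\mathsf T}\xi)_{\mathfrak a},X^{\mathsf T}\eta]+[(X^{\mathsf T}\eta)_{\mathfrak a},X^{\mathsf T}\xi]\bigr)\\&=\tfrac12X(\xi^{\mathsf T}\eta+\eta^{\mathsf T}\xi)+\tfrac{1-2\alpha}{2}X\begin{bmatrix}0&-A_\xi B_\eta^{\mathsf T}-A_\eta B_\xi^{\mathsf T}\\-B_\eta A_\xi-B_\xi A_\eta&0\end{bmatrix}.\end{aligned}$$ 3. The curve $$\gamma(t)=X\exp\left(t\begin{bmatrix}2\alpha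 A_\xi&-B_\xi^{\mathsf T}\\B_\xi&C_\xi\end{bmatrix}\right)\exp\left(t\begin{bmatrix}(1-2\alpha)A_\xi&0\\0&0\end{bmatrix}\right),\quad t\in\mathbb{R},$$ lies in $\mathrm{SO}(n)$ and is the geodesic with $\gamma(0)=X$, $\dot\gamma(0)=\xi$: it satisfies $\ddot\gamma+\Gamma(\gamma;\dot\gamma,\dot\gamma)=0$, and every geodesic with the same initial point and velocity on an open interval containing $0$ agrees with $\gamma$ there. 4. For $t\in\mathbb{R}$, the parallel transport of $\eta$ along $\gamma$ from $0$ to $t$, that is the value $\Delta(t)$ of the vector field $\Delta$ over $\gamma$ with $\dot\Delta(s)+\Gamma(\gamma(s);\dot\gamma(s),\Delta(s))=0$ for all $s$ between $0$ and $t$ and $\Delta(0)=\eta$, exists, is unique, and equals $$X\exp\left(t\begin{bmatrix}2\alpha A_\xi&-B_\xi^{\mathsf T}\\B_\xi&C_\xi\end{bmatrix}\right)\Bigl(\exp(t\mathrm P)\bigl(X^{\mathsf T}\eta\bigr)\Bigr)\exp\left(t\begin{bmatrix}(1-2\alpha)A_\xi&0\\0&0\end{bmatrix}\right),$$ where $\exp(t\mathrm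 P)w=\sum_{k\ge0}\frac{t^k}{k!}\mathrm P^kw$ and, with $\mathtt a=X^{\mathsf T}\xi$ and $\beta=-2\alpha$, $\mathrm P=\mathrm P_{\mathtt a}$ is the operator $$\mathrm P_{\mathtt a}\mathtt b=\tfrac12\bigl([\mathtt b,\mathtt a]+(1+\beta)([\mathtt a_{\mathfrak a},\mathtt b]-[\mathtt b_{\mathfrak a},\mathtt a])\bigr).$$ -/

import Mathlib

open scoped Matrix ContDiff

-- A norm on the matrix space is needed to speak of derivatives; all norms on it are equivalent.
open scoped Matrix.Norms.Operator

noncomputable section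

namespace DeformedSO

/-- Real square matrices of size `n = d + m`, with rows and columns split into a first block of
size `d` and a second block of size `m = n - d`. -/
abbrev Mat (d m : ℕ) : Type := Matrix (Fin d ⊕ Fin m) (Fin d ⊕ Fin m) ℝ

variable {d m : ℕ}

/-- The set `SO(n)` inside the matrix space. -/
def SO (d m : ℕ) : Set (Mat d m) :=
  {X | X ∈ Matrix.specialOrthogonalGroup (Fin d ⊕ Fin m) ℝ}

/-- `ξ` is tangent to `SO(n)` at `X`, that is `X⁻¹ ξ ∈ 𝔰𝔬(n)`. -/
def IsTangent (X ξ : Mat d m) : Prop :=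
  X⁻¹ * ξ ∈ LieAlgebra.Orthogonal.so (Fin d ⊕ Fin m) ℝ

/-- The projection `w ↦ w_𝔞` onto the top-block copy `𝔞` of `𝔰𝔬(d)`: the top `d × d` block is
antisymmetrized and the remaining entries are set to zero. -/
def projA : Mat d m →ₗ[ℝ] Mat d m where
  toFun w := Matrix.fromBlocks ((1 / 2 : ℝ) • (w.toBlocks₁₁ - w.toBlocks₁₁ᵀ)) 0 0 0
  map_add' w₁ w₂ := by
    ext (i | i) (j | j) <;> simp [Matrix.toBlocks₁₁]
    ring
  map_smul' c w := by
    ext (i | i) (j | j) <;> simp [Matrix.toBlocks₁₁]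
    ring

/-- The bilinear form `β₀ (Tr(h g) - Tr(h_𝔞 g_𝔞)) - β₁ Tr(h_𝔞 g_𝔞)` on matrices. -/
def algForm (β₀ β₁ : ℝ) (g h : Mat d m) : ℝ :=
  β₀ * ((h * g).trace - (projA h * projA g).trace) - β₁ * (projA h * projA g).trace

/-- The left-invariant metric `⟨ξ, η⟩_X = ⟨X⁻¹ ξ, X⁻¹ η⟩` defined by the form `algForm β₀ β₁`. -/
def metric (β₀ β₁ : ℝ) (X ξ η : Mat d m) : ℝ :=
  algForm β₀ β₁ (X⁻¹ * ξ) (X⁻¹ * η)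

/-- A smooth vector field on `SO(n)`, given by a smooth extension to the matrix space (`SO(n)` is
a closed submanifold, so every smooth vector field on it has one). -/
structure IsVectorField (V : Mat d m → Mat d m) : Prop where
  smooth : ContDiff ℝ ∞ V
  tangent : ∀ X ∈ SO d m, IsTangent X (V X)

/-- `∇_Y Z = D_Y Z + Γ(Y, Z)` at the point `X`; on `SO(n)` the directional derivative `D_Y Z` does
not depend on the extension of `Z`, because `Y X` is tangent. -/
def covDeriv (Γ : Mat d m → Mat d m → Mat d m → Mat d m) (Y Z : Mat d m → Mat d m)
    (X : Mat d m) : Mat d m :=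
  fderiv ℝ Z X (Y X) + Γ X (Y X) (Z X)

/-- `Γ` is a Christoffel function of the Levi-Civita connection on `SO(n)` of the metric `g`: it is
bilinear on each tangent space, `∇_Y Z = D_Y Z + Γ(Y, Z)` maps vector fields to vector fields, and
`∇` is torsion-free and compatible with `g`. -/
structure IsLeviCivita (g : Mat d m → Mat d m → Mat d m → ℝ)
    (Γ : Mat d m → Mat d m → Mat d m → Mat d m) : Prop where
  add_left : ∀ X ∈ SO d m, ∀ ξ₁ ξ₂ η, IsTangent X ξ₁ → IsTangent X ξ₂ → IsTangent X η →
    Γ X (ξ₁ + ξ₂) η = Γ X ξ₁ η + Γ X ξ₂ η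
  smul_left : ∀ X ∈ SO d m, ∀ (c : ℝ) (ξ η), IsTangent X ξ → IsTangent X η →
    Γ X (c • ξ) η = c • Γ X ξ η
  add_right : ∀ X ∈ SO d m, ∀ ξ η₁ η₂, IsTangent X ξ → IsTangent X η₁ → IsTangent X η₂ →
    Γ X ξ (η₁ + η₂) = Γ X ξ η₁ + Γ X ξ η₂
  smul_right : ∀ X ∈ SO d m, ∀ (c : ℝ) (ξ η), IsTangent X ξ → IsTangent X η →
    Γ X ξ (c • η) = c • Γ X ξ η
  vectorField : ∀ Y Z, IsVectorField Y → IsVectorField Z →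
    ∃ W, IsVectorField W ∧ ∀ X ∈ SO d m, W X = covDeriv Γ Y Z X
  torsionFree : ∀ X ∈ SO d m, ∀ ξ η, IsTangent X ξ → IsTangent X η → Γ X ξ η = Γ X η ξ
  metricCompatible : ∀ Y Z, IsVectorField Y → IsVectorField Z → ∀ X ∈ SO d m,
    fderiv ℝ (fun X' => g X' (Z X') (Z X')) X (Y X) = 2 * g X (Z X) (covDeriv Γ Y Z X)

/-- `γ` is, on the open set `I` of times, a geodesic in `SO(n)`: `γ̈ + Γ(γ; γ̇, γ̇) = 0`. -/
structure IsGeodesicOn (Γ : Mat d m → Mat d m → Mat d m → Mat d m) (I : Set ℝ)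
    (γ : ℝ → Mat d m) : Prop where
  mem : ∀ t ∈ I, γ t ∈ SO d m
  differentiable : ∀ t ∈ I, DifferentiableAt ℝ γ t
  differentiable_deriv : ∀ t ∈ I, DifferentiableAt ℝ (deriv γ) t
  equation : ∀ t ∈ I, deriv (deriv γ) t + Γ (γ t) (deriv γ t) (deriv γ t) = 0

/-- `τ` is the parallel transport of `η` along the curve `γ` from time `0` to time `t`: there is a
vector field `Δ` over `γ` between the times `0` and `t` with `Δ 0 = η`, `Δ t = τ` that solves the
transport equation `Δ̇(s) + Γ(γ(s); γ̇(s), Δ(s)) = 0`. -/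
def IsParallelTransport (Γ : Mat d m → Mat d m → Mat d m → Mat d m) (γ : ℝ → Mat d m) (t : ℝ)
    (η τ : Mat d m) : Prop :=
  ∃ Δ : ℝ → Mat d m, Δ 0 = η ∧ Δ t = τ ∧ ∀ s ∈ Set.uIcc 0 t, IsTangent (γ s) (Δ s) ∧
    HasDerivWithinAt Δ (-Γ (γ s) (deriv γ s) (Δ s)) (Set.uIcc 0 t) s

/-- The operator `P_a b = ½ ([b, a] + (1 + β) ([a_𝔞, b] - [b_𝔞, a]))`. -/
def opP (β : ℝ) (a : Mat d m) : Mat d m →ₗ[ℝ] Mat d m where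
  toFun b := (1 / 2 : ℝ) • (⁅b, a⁆ + (1 + β) • (⁅projA a, b⁆ - ⁅projA b, a⁆))
  map_add' b₁ b₂ := by
    simp only [Ring.lie_def, map_add, add_mul, mul_add]
    module
  map_smul' c b := by
    simp only [Ring.lie_def, map_smul, smul_mul_assoc, mul_smul_comm, RingHom.id_apply]
    module

/-- The exponential action `expm(P) b = ∑ₖ Pᵏ b / k!` of a linear operator `P` on the matrix space
(the series converges, as the space is finite-dimensional). -/
def expAction (P : Mat d m →ₗ[ℝ] Mat d m) (b : Mat d m) : Mat d m :=
  ∑' k : ℕ, ((k.factorial : ℝ)⁻¹) • (P ^ k) b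

/-- The matrix with blocks `A`, `-Bᵀ`, `B`, `C` (antisymmetric when `A` and `C` are). -/
def skewBlocks (A : Matrix (Fin d) (Fin d) ℝ) (B : Matrix (Fin m) (Fin d) ℝ)
    (C : Matrix (Fin m) (Fin m) ℝ) : Mat d m :=
  Matrix.fromBlocks A (-Bᵀ) B C

/-- The curve `X exp(t [2αA, -Bᵀ; B, C]) exp(t [(1 - 2α)A, 0; 0, 0])`. -/
def geodesicSO (α : ℝ) (X : Mat d m) (A : Matrix (Fin d) (Fin d) ℝ)
    (B : Matrix (Fin m) (Fin d) ℝ) (C : Matrix (Fin m) (Fin m) ℝ) (t : ℝ) : Mat d m :=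
  X * NormedSpace.exp (t • skewBlocks ((2 * α) • A) B C) *
    NormedSpace.exp (t • (Matrix.fromBlocks ((1 - 2 * α) • A) 0 0 0 : Mat d m))

end DeformedSO

end

/-! Left translation moves everything to the identity. A tangent vector at `X` is `X * a` with `a`
skew, and the explicit `christoffel` satisfies Γ(X; Xa, Xb) = X · `leftConn α a b`. For the field X
↦ Xb, differentiation along Xa contributes Xab, so metric compatibility reduces to ⟨b, leftConn(a,
b) + ab⟩ = 0 (`algForm_leftConn`), a consequence of cyclicity of the trace and [b, b_𝔞]_𝔞 = 0.
Uniqueness (`IsLeviCivita.eq_christoffel`) is the Koszul argument: the difference D of two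
Christoffel functions is symmetric in its arguments, while ⟨ζ, D(ξ, η)⟩ is skew in ζ and η, which
forces D = 0 once the form is nondegenerate, i.e. α ≠ 0.

For the curves, put M = a - (1 - 2α) a_𝔞 and N = (1 - 2α) a_𝔞, so that M + N = a, and let `twist`
send w to X exp(tM) w exp(tN). The claimed geodesic is the twist of 1, and its velocity is the twist
of a. Since exp(tN) is orthogonal and commutes with the block projection, conjugation by it respects
`leftConn`; hence Γ along the curve, evaluated on twists of v and w, is the twist of leftConn(v, w)
(`christoffel_twist`). The product rule then turns the transport equation for the twist of w into w'
= -Mw - wN - leftConn(a, w), whose right side is P_a w (`opP_apply`). This has constant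
coefficients, so w(t) = exp(tP_a) w(0); the geodesic equation is the special case P_a a = 0
(`leftConn_self`). Uniqueness of geodesics is ODE uniqueness in the whole matrix space, where
`christoffel` is smooth. -/

noncomputable section

namespace DeformedSO

/-! ### Algebra of the block projection, the connection and the bilinear form -/

section Algebra

variable {d m : ℕ}

/-- The orthogonal projection onto the first block of coordinates. -/
def blockProj (d m : ℕ) : Mat d m := Matrix.fromBlocks 1 0 0 0

lemma blockProj_mul_self : blockProj d m * blockProj d m = blockProj d m := by
  simp [blockProj, Matrix.fromBlocks_multiply]

lemma blockProj_transpose : (blockProj d m)ᵀ = blockProj d m := by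
  simp [blockProj, Matrix.fromBlocks_transpose]

lemma blockProj_mul_mul (w : Mat d m) :
    blockProj d m * w * blockProj d m = Matrix.fromBlocks w.toBlocks₁₁ 0 0 0 := by
  conv_lhs => rw [← Matrix.fromBlocks_toBlocks w]
  simp [blockProj, Matrix.fromBlocks_multiply]

lemma projA_eq (w : Mat d m) :
    projA w = (1 / 2 : ℝ) • (blockProj d m * (w - wᵀ) * blockProj d m) := by
  rw [blockProj_mul_mul]
  ext (i | i) (j | j) <;> simp [projA, Matrix.toBlocks₁₁]

lemma projA_of_skew {w : Mat d m} (hw : wᵀ = -w) :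
    projA w = blockProj d m * w * blockProj d m := by
  rw [projA_eq, hw, sub_neg_eq_add, mul_add, add_mul]
  module

lemma projA_transpose (w : Mat d m) : (projA w)ᵀ = -projA w := by
  simp only [projA_eq, Matrix.transpose_smul, Matrix.transpose_mul, Matrix.transpose_sub,
    Matrix.transpose_transpose, blockProj_transpose, ← smul_neg]
  congr 1
  noncomm_ring

lemma projA_transpose_arg (w : Mat d m) : projA wᵀ = -projA w := by
  simp only [projA_eq, Matrix.transpose_transpose, ← smul_neg]
  congr 1
  noncomm_ring

lemma projA_skewBlocks {A : Matrix (Fin d) (Fin d) ℝ} (hA : Aᵀ = -A)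
    (B : Matrix (Fin m) (Fin d) ℝ) (C : Matrix (Fin m) (Fin m) ℝ) :
    projA (skewBlocks A B C) = Matrix.fromBlocks A 0 0 0 := by
  ext (i | i) (j | j) <;> simp [projA, skewBlocks, hA]
  ring

lemma skewBlocks_transpose {A : Matrix (Fin d) (Fin d) ℝ} (hA : Aᵀ = -A)
    (B : Matrix (Fin m) (Fin d) ℝ) {C : Matrix (Fin m) (Fin m) ℝ} (hC : Cᵀ = -C) :
    (skewBlocks A B C)ᵀ = -skewBlocks A B C := by
  simp [skewBlocks, Matrix.fromBlocks_transpose, hA, hC, Matrix.fromBlocks_neg]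

lemma lie_transpose_of_skew {a b : Mat d m} (ha : aᵀ = -a) (hb : bᵀ = -b) :
    (⁅a, b⁆)ᵀ = -⁅a, b⁆ := by
  simp [Ring.lie_def, ha, hb]

/-- Both ingredients of `projA`, transposition and compression by the block projection, are
compatible with conjugation by a matrix commuting with that projection. -/
lemma projA_conj {Q : Mat d m} (hE : Commute (blockProj d m) Q) (w : Mat d m) :
    projA (Qᵀ * w * Q) = Qᵀ * projA w * Q := by
  have hE' : Qᵀ * blockProj d m = blockProj d m * Qᵀ := by
    have := congrArg Matrix.transpose hE.eq
    simpa [blockProj_transpose] using this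
  have h1 (v : Mat d m) : blockProj d m * (Qᵀ * v * Q) * blockProj d m =
      Qᵀ * (blockProj d m * v * blockProj d m) * Q := by
    calc _ = (blockProj d m * Qᵀ) * v * (Q * blockProj d m) := by noncomm_ring
      _ = _ := by rw [← hE', ← hE.eq]; noncomm_ring
  rw [projA_eq, projA_eq]
  have : Qᵀ * w * Q - (Qᵀ * w * Q)ᵀ = Qᵀ * (w - wᵀ) * Q := by
    simp only [Matrix.transpose_mul, Matrix.transpose_transpose]; noncomm_ring
  rw [this, h1, mul_smul_comm, smul_mul_assoc]

/-- The value of the connection on left-invariant fields, translated to the identity. -/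
def leftConn (α : ℝ) (a b : Mat d m) : Mat d m :=
  -((1 / 2 : ℝ) • (a * b + b * a)) + ((1 - 2 * α) / 2) • (⁅projA a, b⁆ + ⁅projA b, a⁆)

/-- The explicit Christoffel function. -/
def christoffel (α : ℝ) (X ξ η : Mat d m) : Mat d m :=
  (1 / 2 : ℝ) • (X * (ξᵀ * η + ηᵀ * ξ)) +
    ((1 - 2 * α) / 2) • (X * (⁅projA (Xᵀ * ξ), Xᵀ * η⁆ + ⁅projA (Xᵀ * η), Xᵀ * ξ⁆))

lemma christoffel_mul (α : ℝ) {X a b : Mat d m} (hX : Xᵀ * X = 1) (ha : aᵀ = -a) (hb : bᵀ = -b) :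
    christoffel α X (X * a) (X * b) = X * leftConn α a b := by
  have h (v : Mat d m) : Xᵀ * (X * v) = v := by rw [← mul_assoc, hX, one_mul]
  have h' (u v : Mat d m) : (X * u)ᵀ * (X * v) = uᵀ * v := by
    rw [Matrix.transpose_mul, mul_assoc, h]
  rw [christoffel, leftConn, h, h, h', h', ha, hb, mul_add X (-_), mul_smul_comm, ← smul_neg,
    mul_smul_comm]
  congr 3
  noncomm_ring

/-- `projA` acts as an orthogonal projection for the trace form: cyclicity lets `projA g` absorb the
compression, and skewness of `projA g` makes only the antisymmetric part of `w` count. -/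
lemma trace_projA_mul (w g : Mat d m) :
    (projA w * projA g).trace = (w * projA g).trace := by
  set E := blockProj d m with hE
  have hEE : E * E = E := blockProj_mul_self
  have hg : E * projA g * E = projA g := by
    rw [projA_eq, mul_smul_comm, smul_mul_assoc]
    congr 1
    calc _ = (E * E) * (g - gᵀ) * (E * E) := by noncomm_ring
      _ = _ := by rw [hEE]
  have h1 (v : Mat d m) : (E * v * E * projA g).trace = (v * projA g).trace := by
    rw [show E * v * E * projA g = E * (v * (E * projA g)) by noncomm_ring, Matrix.trace_mul_comm,
      ← hg]
    congr 1
    calc _ = v * ((E * E) * projA g * (E * E)) := by noncomm_ring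
      _ = _ := by rw [hEE]
  have h2 : (wᵀ * projA g).trace = -(w * projA g).trace := by
    rw [← Matrix.trace_transpose, Matrix.transpose_mul, projA_transpose, Matrix.transpose_transpose,
      neg_mul, Matrix.trace_neg, Matrix.trace_mul_comm]
  rw [projA_eq w, smul_mul_assoc, Matrix.trace_smul, h1, sub_mul, Matrix.trace_sub, h2]
  simp only [smul_eq_mul]
  ring

lemma trace_mul_projA_comm (w g : Mat d m) :
    (w * projA g).trace = (projA w * g).trace := by
  rw [← trace_projA_mul, Matrix.trace_mul_comm, trace_projA_mul, Matrix.trace_mul_comm]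

/-- With E the block projection, both terms of the compressed bracket equal EbEbE. -/
lemma projA_lie_projA {b : Mat d m} (hb : bᵀ = -b) : projA ⁅b, projA b⁆ = 0 := by
  rw [projA_of_skew (lie_transpose_of_skew hb (projA_transpose b)), projA_of_skew hb,
    Ring.lie_def]
  set E := blockProj d m
  have hEE : E * E = E := blockProj_mul_self
  calc E * (b * (E * b * E) - E * b * E * b) * E
      = E * b * E * b * (E * E) - (E * E) * b * E * b * E := by noncomm_ring
    _ = 0 := by rw [hEE]; simp

lemma algForm_eq (α : ℝ) (g h : Mat d m) :
    algForm (-1 / 2) α g h =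
      -(1 / 2) * (h * g).trace + (1 / 2 - α) * (h * projA g).trace := by
  rw [algForm, trace_projA_mul]
  ring

lemma algForm_comm (β₀ β₁ : ℝ) (g h : Mat d m) : algForm β₀ β₁ g h = algForm β₀ β₁ h g := by
  rw [algForm, algForm, Matrix.trace_mul_comm h, Matrix.trace_mul_comm (projA h)]

lemma algForm_add_right (β₀ β₁ : ℝ) (g h h' : Mat d m) :
    algForm β₀ β₁ g (h + h') = algForm β₀ β₁ g h + algForm β₀ β₁ g h' := by
  simp only [algForm, map_add, add_mul, Matrix.trace_add]
  ring

lemma algForm_smul_right (β₀ β₁ c : ℝ) (g h : Mat d m) :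
    algForm β₀ β₁ g (c • h) = c * algForm β₀ β₁ g h := by
  simp only [algForm, map_smul, smul_mul_assoc, Matrix.trace_smul, smul_eq_mul]
  ring

lemma trace_lie_mul (a b c : Mat d m) : (⁅a, b⁆ * c).trace = (a * ⁅b, c⁆).trace := by
  rw [Ring.lie_def, Ring.lie_def, sub_mul, mul_sub, Matrix.trace_sub, Matrix.trace_sub,
    mul_assoc b a c, Matrix.trace_mul_comm b, mul_assoc, mul_assoc]

/-- This is metric compatibility for left-invariant fields. Every trace vanishes by invariance or by
[b, b_𝔞]_𝔞 = 0, except tr([b_𝔞, a] b) = tr([a, b] b_𝔞); these two enter with opposite coefficients.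
-/
lemma algForm_leftConn (α : ℝ) (a : Mat d m) {b : Mat d m} (hb : bᵀ = -b) :
    algForm (-1 / 2) α b (leftConn α a b + a * b) = 0 := by
  have h0 : leftConn α a b + a * b = (1 / 2 : ℝ) • ⁅a, b⁆ +
      ((1 - 2 * α) / 2) • (⁅projA a, b⁆ + ⁅projA b, a⁆) := by
    rw [leftConn, Ring.lie_def a b]
    module
  have h1 : (⁅a, b⁆ * b).trace = 0 := by
    rw [trace_lie_mul, Ring.lie_def, sub_self, mul_zero, Matrix.trace_zero]
  have h2 : (⁅projA a, b⁆ * b).trace = 0 := by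
    rw [trace_lie_mul, Ring.lie_def, sub_self, mul_zero, Matrix.trace_zero]
  have h3 : (⁅projA b, a⁆ * projA b).trace = 0 := by
    rw [Matrix.trace_mul_comm, ← trace_lie_mul]; simp [Ring.lie_def]
  have h4 : (⁅projA a, b⁆ * projA b).trace = 0 := by
    rw [trace_lie_mul, ← trace_mul_projA_comm, projA_lie_projA hb]; simp
  have h5 : (⁅projA b, a⁆ * b).trace = (⁅a, b⁆ * projA b).trace := by
    rw [trace_lie_mul, Matrix.trace_mul_comm]
  rw [h0, algForm_eq]
  simp only [add_mul, smul_mul_assoc, smul_add, Matrix.trace_add, Matrix.trace_smul, h1, h2, h3, h4,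
    h5, smul_eq_mul]
  ring

lemma eq_zero_of_trace_mul_self {b : Mat d m} (hb : bᵀ = -b) (h : (b * b).trace = 0) : b = 0 := by
  have h1 : (bᵀ * b).trace = 0 := by rw [hb, neg_mul, Matrix.trace_neg, h, neg_zero]
  exact Matrix.trace_conjTranspose_mul_self_eq_zero_iff.mp (by simpa using h1)

lemma projA_projA (w : Mat d m) : projA (projA w) = projA w := by
  rw [projA_of_skew (projA_transpose w), projA_eq]
  set E := blockProj d m
  have hEE : E * E = E := blockProj_mul_self
  rw [mul_smul_comm, smul_mul_assoc]
  congr 1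
  calc _ = (E * E) * (w - wᵀ) * (E * E) := by noncomm_ring
    _ = _ := by rw [hEE]

/-- The form is indefinite or definite depending on the sign of α, so testing against `b` alone is
not enough. Testing against b_𝔞 gives -α tr(b_𝔞²) = 0, hence b_𝔞 = 0; then testing against `b`
leaves -½ tr(b²) = 0. -/
lemma algForm_nondegenerate {α : ℝ} (hα : α ≠ 0) {b : Mat d m} (hb : bᵀ = -b)
    (h : ∀ c : Mat d m, cᵀ = -c → algForm (-1 / 2) α c b = 0) : b = 0 := by
  have h1 := h (projA b) (projA_transpose b)
  rw [algForm_eq, projA_projA, ← trace_projA_mul] at h1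
  have h2 : (projA b * projA b).trace = 0 := by
    have : α * (projA b * projA b).trace = 0 := by linarith
    exact (mul_eq_zero.mp this).resolve_left hα
  have h3 := eq_zero_of_trace_mul_self (projA_transpose b) h2
  have h4 := h b hb
  rw [algForm_eq, h3] at h4
  exact eq_zero_of_trace_mul_self hb (by simpa using h4)

end Algebra

/-! ### The group SO(n) and its tangent spaces -/

section Group

variable {d m : ℕ} {X : Mat d m}

lemma transpose_mul_self_of_mem_SO (hX : X ∈ SO d m) : Xᵀ * X = 1 :=
  (Matrix.mem_orthogonalGroup_iff' _ _).mp (Matrix.mem_specialOrthogonalGroup_iff.mp hX).1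

lemma transpose_mul_cancel_of_mem_SO (hX : X ∈ SO d m) (v : Mat d m) : Xᵀ * (X * v) = v := by
  rw [← mul_assoc, transpose_mul_self_of_mem_SO hX, one_mul]

lemma inv_eq_transpose_of_mem_SO (hX : X ∈ SO d m) : X⁻¹ = Xᵀ :=
  Matrix.inv_eq_left_inv (transpose_mul_self_of_mem_SO hX)

lemma mul_transpose_cancel_of_mem_SO (hX : X ∈ SO d m) (v : Mat d m) : X * (Xᵀ * v) = v := by
  rw [← mul_assoc, mul_eq_one_comm.mp (transpose_mul_self_of_mem_SO hX), one_mul]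

lemma mul_mem_SO {Y : Mat d m} (hX : X ∈ SO d m) (hY : Y ∈ SO d m) : X * Y ∈ SO d m :=
  Submonoid.mul_mem (Matrix.specialOrthogonalGroup (Fin d ⊕ Fin m) ℝ) hX hY

lemma isTangent_iff (hX : X ∈ SO d m) (ξ : Mat d m) :
    IsTangent X ξ ↔ (Xᵀ * ξ)ᵀ = -(Xᵀ * ξ) := by
  rw [IsTangent, LieAlgebra.Orthogonal.mem_so, inv_eq_transpose_of_mem_SO hX]

lemma isTangent_mul_iff (hX : X ∈ SO d m) (a : Mat d m) : IsTangent X (X * a) ↔ aᵀ = -a := by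
  rw [isTangent_iff hX, transpose_mul_cancel_of_mem_SO hX]

lemma isTangent_iff_exists (hX : X ∈ SO d m) (ξ : Mat d m) :
    IsTangent X ξ ↔ ∃ a : Mat d m, aᵀ = -a ∧ ξ = X * a := by
  constructor
  · exact fun h => ⟨_, (isTangent_iff hX ξ).mp h, (mul_transpose_cancel_of_mem_SO hX ξ).symm⟩
  · rintro ⟨a, ha, rfl⟩
    exact (isTangent_mul_iff hX a).mpr ha

lemma exp_transpose_mul_exp {a : Mat d m} (ha : aᵀ = -a) :
    (NormedSpace.exp a)ᵀ * NormedSpace.exp a = 1 := by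
  rw [← Matrix.exp_transpose, ha, ← Matrix.exp_add_of_commute _ _ (Commute.refl a).neg_left]
  simp

lemma exp_mem_SO {a : Mat d m} (ha : aᵀ = -a) : NormedSpace.exp a ∈ SO d m := by
  refine Matrix.mem_specialOrthogonalGroup_iff.mpr
    ⟨(Matrix.mem_orthogonalGroup_iff' _ _).mpr (exp_transpose_mul_exp ha), ?_⟩
  -- Orthogonality only gives determinant ±1; writing exp a as the square of exp(a/2) makes the
  -- determinant a square, hence 1.
  have hb : ((1 / 2 : ℝ) • a)ᵀ = -((1 / 2 : ℝ) • a) := by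
    rw [Matrix.transpose_smul, ha, smul_neg]
  have h1 := congrArg Matrix.det (exp_transpose_mul_exp hb)
  rw [Matrix.det_mul, Matrix.det_transpose, Matrix.det_one] at h1
  have h2 : a = (1 / 2 : ℝ) • a + (1 / 2 : ℝ) • a := by module
  rw [h2, Matrix.exp_add_of_commute _ _ (Commute.refl _), Matrix.det_mul, h1]

lemma smul_transpose_of_skew {a : Mat d m} (ha : aᵀ = -a) (t : ℝ) : (t • a)ᵀ = -(t • a) := by
  rw [Matrix.transpose_smul, ha, smul_neg]

end Group

/-! ### Derivatives of exponentials, inverses and quadratic forms -/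

section NormedRing

variable {R : Type*} [NormedRing R] [NormedAlgebra ℝ R] [CompleteSpace R]

lemma hasDerivAt_mul_exp (X a : R) (t : ℝ) :
    HasDerivAt (fun s : ℝ => X * NormedSpace.exp (s • a)) (X * NormedSpace.exp (t • a) * a) t := by
  rw [mul_assoc]
  exact (hasDerivAt_exp_smul_const a t).const_mul X

lemma hasFDerivAt_ringInverse_mul (u : Rˣ) {Z : R → R} {Z' : R →L[ℝ] R}
    (hZ : HasFDerivAt Z Z' (u : R)) :
    ∃ z' : R →L[ℝ] R, HasFDerivAt (fun X => Ring.inverse X * Z X) z' (u : R) ∧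
      ∀ v, z' v = (u⁻¹ : Rˣ) * Z' v - (u⁻¹ : Rˣ) * v * ((u⁻¹ : Rˣ) * Z u) := by
  refine ⟨_, (hasFDerivAt_ringInverse (𝕜 := ℝ) u).mul' hZ, fun v => ?_⟩
  simp [sub_eq_add_neg, mul_assoc]

end NormedRing

lemma hasFDerivAt_symm_bilinear {E : Type*} [NormedAddCommGroup E] [NormedSpace ℝ E]
    (B : E →L[ℝ] E →L[ℝ] ℝ) (hB : ∀ u v, B u v = B v u) {z : E → E} {z' : E →L[ℝ] E} {x : E}
    (hz : HasFDerivAt z z' x) :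
    ∃ f' : E →L[ℝ] ℝ, HasFDerivAt (fun y => B (z y) (z y)) f' x ∧
      ∀ v, f' v = 2 * B (z x) (z' v) := by
  refine ⟨_, B.hasFDerivAt_of_bilinear hz hz, fun v => ?_⟩
  have h : B (z x) (z' v) + B (z' v) (z x) = 2 * B (z x) (z' v) := by rw [hB (z' v)]; ring
  exact h

/-! ### Differentiating vector fields and the metric -/

section Calculus

variable {d m : ℕ}

/-- Transposition as a continuous linear map. -/
def transposeL (d m : ℕ) : Mat d m →L[ℝ] Mat d m :=
  LinearMap.toContinuousLinearMap (Matrix.transposeLinearEquiv _ _ ℝ ℝ).toLinearMap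

/-- The projection `projA` as a continuous linear map. -/
def projAL (d m : ℕ) : Mat d m →L[ℝ] Mat d m :=
  LinearMap.toContinuousLinearMap projA

lemma hasDerivAt_transpose {f : ℝ → Mat d m} {f' : Mat d m} {t : ℝ} (hf : HasDerivAt f f' t) :
    HasDerivAt (fun s => (f s)ᵀ) f'ᵀ t :=
  (transposeL d m).hasFDerivAt.comp_hasDerivAt t hf

/-- The formula uses `Xᵀ` in place of `X⁻¹`, so it is polynomial on the whole matrix space and not
only smooth near SO(n). -/
lemma contDiff_christoffel {F : Type*} [NormedAddCommGroup F] [NormedSpace ℝ F] {n : WithTop ℕ∞}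
    (α : ℝ) {X ξ η : F → Mat d m} (hX : ContDiff ℝ n X) (hξ : ContDiff ℝ n ξ)
    (hη : ContDiff ℝ n η) : ContDiff ℝ n (fun p => christoffel α (X p) (ξ p) (η p)) := by
  have hT {f : F → Mat d m} (hf : ContDiff ℝ n f) : ContDiff ℝ n (fun p => (f p)ᵀ) :=
    (transposeL d m).contDiff.comp hf
  have hP {f : F → Mat d m} (hf : ContDiff ℝ n f) : ContDiff ℝ n (fun p => projA (f p)) :=
    (projAL d m).contDiff.comp hf
  have hL {f g : F → Mat d m} (hf : ContDiff ℝ n f) (hg : ContDiff ℝ n g) :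
      ContDiff ℝ n (fun p => ⁅f p, g p⁆) := by
    simp only [Ring.lie_def]
    exact (hf.mul hg).sub (hg.mul hf)
  exact ((hX.mul (((hT hξ).mul hη).add ((hT hη).mul hξ))).const_smul _).add
    ((hX.mul ((hL (hP ((hT hX).mul hξ)) ((hT hX).mul hη)).add
      (hL (hP ((hT hX).mul hη)) ((hT hX).mul hξ)))).const_smul _)

/-- Differentiate the tangency identity γᵀZ(γ) + Z(γ)ᵀγ = 0 at 0 along γ(s) = X exp(sa). The result
measures how far the plain derivative of `Z` is from being tangent. -/
lemma IsVectorField.fderiv_skew {Z : Mat d m → Mat d m} (hZ : IsVectorField Z) {X a : Mat d m}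
    (hX : X ∈ SO d m) (ha : aᵀ = -a) :
    (Xᵀ * fderiv ℝ Z X (X * a))ᵀ + Xᵀ * fderiv ℝ Z X (X * a) =
      -((X * a)ᵀ * Z X + (Z X)ᵀ * (X * a)) := by
  have hγ : HasDerivAt (fun s : ℝ => X * NormedSpace.exp (s • a)) (X * a) 0 := by
    have h := hasDerivAt_mul_exp X a 0
    rwa [zero_smul, NormedSpace.exp_zero, mul_one] at h
  have h0 : X * NormedSpace.exp ((0 : ℝ) • a) = X := by simp
  have hZd : HasDerivAt (fun s : ℝ => Z (X * NormedSpace.exp (s • a))) (fderiv ℝ Z X (X * a)) 0 := by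
    refine HasFDerivAt.comp_hasDerivAt (0 : ℝ) (l := Z) ?_ hγ
    rw [h0]
    exact (hZ.smooth.differentiable (by simp) X).hasFDerivAt
  have hf := ((hasDerivAt_transpose hγ).mul hZd).add ((hasDerivAt_transpose hZd).mul hγ)
  have hzero : (fun s : ℝ => (X * NormedSpace.exp (s • a))ᵀ) *
      (fun s : ℝ => Z (X * NormedSpace.exp (s • a))) +
      (fun s : ℝ => (Z (X * NormedSpace.exp (s • a)))ᵀ) *
      (fun s : ℝ => X * NormedSpace.exp (s • a)) = fun _ => 0 := by
    funext s
    have hs : X * NormedSpace.exp (s • a) ∈ SO d m :=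
      mul_mem_SO hX (exp_mem_SO (smul_transpose_of_skew ha s))
    have h1 := (isTangent_iff hs _).mp (hZ.tangent _ hs)
    rw [Matrix.transpose_mul, Matrix.transpose_transpose] at h1
    simp only [Pi.add_apply, Pi.mul_apply]
    rw [h1, add_neg_cancel]
  rw [hzero] at hf
  have h2 := hf.unique (hasDerivAt_const (0 : ℝ) (0 : Mat d m))
  simp only [h0] at h2
  rw [Matrix.transpose_mul (Xᵀ), Matrix.transpose_transpose, eq_neg_iff_add_eq_zero, ← h2]
  abel

lemma contDiff_covDeriv_christoffel (α : ℝ) {Y Z : Mat d m → Mat d m} (hY : ContDiff ℝ ∞ Y)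
    (hZ : ContDiff ℝ ∞ Z) : ContDiff ℝ ∞ (covDeriv (christoffel α) Y Z) :=
  ((hZ.fderiv_right (m := ∞) (by simp)).clm_apply hY).add
    (contDiff_christoffel α contDiff_id hY hZ)

/-- The derivative fails to be tangent by the symmetric part ½(ab + ba), which the first term of
`leftConn` cancels; the brackets in `leftConn` are already skew. -/
lemma isVectorField_covDeriv_christoffel (α : ℝ) {Y Z : Mat d m → Mat d m}
    (hY : IsVectorField Y) (hZ : IsVectorField Z) :
    IsVectorField (covDeriv (christoffel α) Y Z) := by
  refine ⟨contDiff_covDeriv_christoffel α hY.smooth hZ.smooth, fun X hX => ?_⟩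
  obtain ⟨a, ha, hYa⟩ := (isTangent_iff_exists hX _).mp (hY.tangent X hX)
  obtain ⟨b, hb, hZb⟩ := (isTangent_iff_exists hX _).mp (hZ.tangent X hX)
  have h := hZ.fderiv_skew hX ha
  set D := Xᵀ * fderiv ℝ Z X (X * a) with hD
  rw [hZb, Matrix.transpose_mul X a, Matrix.transpose_mul X b, mul_assoc, mul_assoc,
    transpose_mul_cancel_of_mem_SO hX, transpose_mul_cancel_of_mem_SO hX, ha, hb] at h
  rw [isTangent_iff hX, covDeriv, hYa, hZb,
    christoffel_mul α (transpose_mul_self_of_mem_SO hX) ha hb, mul_add,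
    transpose_mul_cancel_of_mem_SO hX, ← hD, Matrix.transpose_add, leftConn, Matrix.transpose_add,
    Matrix.transpose_neg, Matrix.transpose_smul, Matrix.transpose_smul, Matrix.transpose_add,
    Matrix.transpose_add, lie_transpose_of_skew (projA_transpose a) hb,
    lie_transpose_of_skew (projA_transpose b) ha, Matrix.transpose_mul a b, Matrix.transpose_mul b a, ha,
    hb, eq_sub_of_add_eq h]
  simp only [neg_mul, mul_neg, neg_neg]
  module

/-- The form `algForm β₀ β₁` as a continuous bilinear map. -/
def algFormL (d m : ℕ) (β₀ β₁ : ℝ) : Mat d m →L[ℝ] Mat d m →L[ℝ] ℝ :=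
  LinearMap.toContinuousBilinearMap <| LinearMap.mk₂ ℝ (algForm β₀ β₁)
    (fun g g' h => by rw [algForm_comm, algForm_add_right, algForm_comm _ _ h, algForm_comm _ _ h])
    (fun c g h => by rw [algForm_comm, algForm_smul_right, algForm_comm _ _ h, smul_eq_mul])
    (fun g h h' => algForm_add_right _ _ _ _ _)
    (fun c g h => algForm_smul_right _ _ _ _ _)

lemma hasFDerivAt_inv_mul {Z : Mat d m → Mat d m} {X : Mat d m} (hX : X ∈ SO d m)
    (hZ : DifferentiableAt ℝ Z X) :
    ∃ z' : Mat d m →L[ℝ] Mat d m, HasFDerivAt (fun X' => X'⁻¹ * Z X') z' X ∧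
      ∀ v, z' v = Xᵀ * fderiv ℝ Z X v - Xᵀ * v * (Xᵀ * Z X) := by
  let u : (Mat d m)ˣ := ⟨X, Xᵀ, mul_eq_one_comm.mp (transpose_mul_self_of_mem_SO hX),
    transpose_mul_self_of_mem_SO hX⟩
  obtain ⟨z', hz, hz'⟩ := hasFDerivAt_ringInverse_mul u (Z := Z) hZ.hasFDerivAt
  refine ⟨z', ?_, hz'⟩
  simp only [Matrix.nonsing_inv_eq_ringInverse]
  exact hz

lemma fderiv_metric {β₀ β₁ : ℝ} {Z : Mat d m → Mat d m} {X : Mat d m} (hX : X ∈ SO d m)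
    (hZ : DifferentiableAt ℝ Z X) (v : Mat d m) :
    fderiv ℝ (fun X' => metric β₀ β₁ X' (Z X') (Z X')) X v =
      2 * algForm β₀ β₁ (Xᵀ * Z X) (Xᵀ * fderiv ℝ Z X v - Xᵀ * v * (Xᵀ * Z X)) := by
  obtain ⟨z', hz, hz'⟩ := hasFDerivAt_inv_mul hX hZ
  obtain ⟨f', hf, hf'⟩ := hasFDerivAt_symm_bilinear (algFormL d m β₀ β₁)
    (fun u v => algForm_comm _ _ _ _) hz
  have h : HasFDerivAt (fun X' => metric β₀ β₁ X' (Z X') (Z X')) f' X := hf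
  refine (DFunLike.congr_fun h.fderiv v).trans ((hf' v).trans ?_)
  change 2 * algForm β₀ β₁ (X⁻¹ * Z X) (z' v) = _
  rw [hz' v, inv_eq_transpose_of_mem_SO hX]

end Calculus

/-! ### Existence and uniqueness of the Levi-Civita connection -/

section LeviCivita

variable {d m : ℕ}

lemma isLeviCivita_christoffel (α : ℝ) :
    IsLeviCivita (d := d) (m := m) (metric (-1 / 2) α) (christoffel α) where
  add_left X hX ξ₁ ξ₂ η _ _ _ := by
    simp only [christoffel, Ring.lie_def, Matrix.transpose_add, map_add, add_mul, mul_add, mul_sub]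
    module
  smul_left X hX c ξ η _ _ := by
    simp only [christoffel, Ring.lie_def, Matrix.transpose_smul, map_smul, smul_mul_assoc,
      mul_smul_comm, mul_add, mul_sub]
    module
  add_right X hX ξ η₁ η₂ _ _ _ := by
    simp only [christoffel, Ring.lie_def, Matrix.transpose_add, map_add, add_mul, mul_add, mul_sub]
    module
  smul_right X hX c ξ η _ _ := by
    simp only [christoffel, Ring.lie_def, Matrix.transpose_smul, map_smul, smul_mul_assoc,
      mul_smul_comm, mul_add, mul_sub]
    module
  vectorField Y Z hY hZ := ⟨_, isVectorField_covDeriv_christoffel α hY hZ, fun _ _ => rfl⟩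
  torsionFree X _ ξ η _ _ := by
    rw [christoffel, christoffel, add_comm (ξᵀ * η), add_comm ⁅projA (Xᵀ * ξ), Xᵀ * η⁆]
  metricCompatible Y Z hY hZ X hX := by
    obtain ⟨a, ha, hYa⟩ := (isTangent_iff_exists hX _).mp (hY.tangent X hX)
    obtain ⟨b, hb, hZb⟩ := (isTangent_iff_exists hX _).mp (hZ.tangent X hX)
    rw [fderiv_metric hX (hZ.smooth.differentiable (by simp) X), metric, covDeriv, hYa, hZb,
      christoffel_mul α (transpose_mul_self_of_mem_SO hX) ha hb, inv_eq_transpose_of_mem_SO hX,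
      transpose_mul_cancel_of_mem_SO hX, transpose_mul_cancel_of_mem_SO hX, mul_add,
      transpose_mul_cancel_of_mem_SO hX]
    have h := algForm_leftConn α a hb
    have h1 : Xᵀ * fderiv ℝ Z X (X * a) + leftConn α a b =
        (Xᵀ * fderiv ℝ Z X (X * a) - a * b) + (leftConn α a b + a * b) := by abel
    rw [h1, algForm_add_right, h, add_zero]

lemma isVectorField_mul {a : Mat d m} (ha : aᵀ = -a) : IsVectorField (fun X : Mat d m => X * a) :=
  ⟨contDiff_id.mul contDiff_const, fun _ hX => (isTangent_mul_iff hX a).mpr ha⟩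

lemma isTangent_sub {X ξ η : Mat d m} (hX : X ∈ SO d m) (hξ : IsTangent X ξ)
    (hη : IsTangent X η) : IsTangent X (ξ - η) := by
  rw [isTangent_iff hX] at *
  rw [mul_sub, Matrix.transpose_sub, hξ, hη]
  abel

lemma isTangent_add {X ξ η : Mat d m} (hX : X ∈ SO d m) (hξ : IsTangent X ξ)
    (hη : IsTangent X η) : IsTangent X (ξ + η) := by
  rw [isTangent_iff hX] at *
  rw [mul_add, Matrix.transpose_add, hξ, hη]
  abel

lemma metric_add_right {β₀ β₁ : ℝ} (X ξ η ζ : Mat d m) :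
    metric β₀ β₁ X ξ (η + ζ) = metric β₀ β₁ X ξ η + metric β₀ β₁ X ξ ζ := by
  rw [metric, mul_add, algForm_add_right]; rfl

lemma metric_sub_right {β₀ β₁ : ℝ} (X ξ η ζ : Mat d m) :
    metric β₀ β₁ X ξ (η - ζ) = metric β₀ β₁ X ξ η - metric β₀ β₁ X ξ ζ := by
  rw [eq_sub_iff_add_eq, ← metric_add_right, sub_add_cancel]

lemma metric_comm {β₀ β₁ : ℝ} (X ξ η : Mat d m) :
    metric β₀ β₁ X ξ η = metric β₀ β₁ X η ξ := algForm_comm _ _ _ _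

lemma metric_nondegenerate {α : ℝ} (hα : α ≠ 0) {X ξ : Mat d m} (hX : X ∈ SO d m)
    (hξ : IsTangent X ξ) (h : ∀ ζ, IsTangent X ζ → metric (-1 / 2) α X ζ ξ = 0) : ξ = 0 := by
  obtain ⟨b, hb, rfl⟩ := (isTangent_iff_exists hX _).mp hξ
  rw [algForm_nondegenerate hα hb, mul_zero]
  intro c hc
  have := h (X * c) ((isTangent_mul_iff hX c).mpr hc)
  rwa [metric, inv_eq_transpose_of_mem_SO hX, transpose_mul_cancel_of_mem_SO hX,
    transpose_mul_cancel_of_mem_SO hX] at this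

lemma IsLeviCivita.eq_christoffel {α : ℝ} (hα : α ≠ 0)
    {Γ : Mat d m → Mat d m → Mat d m → Mat d m} (hΓ : IsLeviCivita (metric (-1 / 2) α) Γ)
    {X : Mat d m} (hX : X ∈ SO d m) {ξ η : Mat d m} (hξ : IsTangent X ξ) (hη : IsTangent X η) :
    Γ X ξ η = christoffel α X ξ η := by
  have hΓ' := isLeviCivita_christoffel (d := d) (m := m) α
  set g := metric (d := d) (m := m) (-1 / 2) α with hg
  set D := fun ξ η => Γ X ξ η - christoffel α X ξ η with hD
  -- Extending tangent vectors by left-invariant fields makes the derivative terms cancel in the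
  -- difference of the two connections.
  have hfields {ξ η : Mat d m} (hξ : IsTangent X ξ) (hη : IsTangent X η) :
      IsTangent X (D ξ η) ∧ g X η (D ξ η) = 0 := by
    obtain ⟨a, ha, rfl⟩ := (isTangent_iff_exists hX _).mp hξ
    obtain ⟨b, hb, rfl⟩ := (isTangent_iff_exists hX _).mp hη
    have ha' := isVectorField_mul ha
    have hb' := isVectorField_mul hb
    have hdiff : D (X * a) (X * b) =
        covDeriv Γ (fun X => X * a) (fun X => X * b) X -
          covDeriv (christoffel α) (fun X => X * a) (fun X => X * b) X := by
      simp only [hD, covDeriv]; abel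
    constructor
    · obtain ⟨W, hW, hWX⟩ := hΓ.vectorField _ _ ha' hb'
      obtain ⟨W', hW', hWX'⟩ := hΓ'.vectorField _ _ ha' hb'
      rw [hdiff, ← hWX X hX, ← hWX' X hX]
      exact isTangent_sub hX (hW.tangent X hX) (hW'.tangent X hX)
    · have h1 := hΓ.metricCompatible _ _ ha' hb' X hX
      have h2 := hΓ'.metricCompatible _ _ ha' hb' X hX
      rw [hdiff, hg, metric_sub_right, ← hg]
      linarith
  have hsymm {ξ η : Mat d m} (hξ : IsTangent X ξ) (hη : IsTangent X η) : D ξ η = D η ξ := by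
    simp only [hD]
    rw [hΓ.torsionFree X hX ξ η hξ hη, hΓ'.torsionFree X hX ξ η hξ hη]
  -- Polarization in η of ⟨η, D(ξ, η)⟩ = 0.
  have hskew {ξ η ζ : Mat d m} (hξ : IsTangent X ξ) (hη : IsTangent X η) (hζ : IsTangent X ζ) :
      g X ζ (D ξ η) = -g X η (D ξ ζ) := by
    have hadd : D ξ (η + ζ) = D ξ η + D ξ ζ := by
      simp only [hD]
      rw [hΓ.add_right X hX ξ η ζ hξ hη hζ, hΓ'.add_right X hX ξ η ζ hξ hη hζ]
      abel
    have h1 := (hfields hξ (isTangent_add hX hη hζ)).2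
    have h2 := (hfields hξ hη).2
    have h3 := (hfields hξ hζ).2
    rw [hadd, hg, metric_add_right, metric_comm X (η + ζ), metric_comm X (η + ζ), metric_add_right,
      metric_add_right, metric_comm X _ η, metric_comm X _ ζ, metric_comm X _ η,
      metric_comm X _ ζ, ← hg] at h1
    linarith
  refine sub_eq_zero.mp (metric_nondegenerate hα hX (hfields hξ hη).1 fun ζ hζ => ?_)
  change g X ζ (D ξ η) = 0
  -- Alternating skewness and symmetry around the cycle of three arguments returns ⟨ζ, D(ξ, η)⟩ with
  -- three sign changes, so it equals its own negative.
  have e1 := hskew hξ hη hζ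
  have e2 := hskew hζ hξ hη
  have e3 := hskew hη hζ hξ
  rw [hsymm hξ hζ] at e1
  rw [hsymm hζ hη] at e2
  rw [hsymm hη hξ] at e3
  linarith

end LeviCivita

/-! ### Uniqueness for autonomous and linear differential equations -/

section ODE

variable {E : Type*} [NormedAddCommGroup E] [NormedSpace ℝ E]

lemma eqOn_of_hasDerivAt_of_contDiff {v : E → E} (hv : ContDiff ℝ 1 v) {I : Set ℝ}
    (hI : IsOpen I) (hI' : IsPreconnected I) {f g : ℝ → E}
    (hf : ∀ t ∈ I, HasDerivAt f (v (f t)) t) (hg : ∀ t ∈ I, HasDerivAt g (v (g t)) t)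
    {t₀ : ℝ} (ht₀ : t₀ ∈ I) (h₀ : f t₀ = g t₀) : Set.EqOn f g I := by
  intro t ht
  have hlow {x : ℝ} (hx : x ∈ I) : ∃ y ∈ I, y < x := by
    obtain ⟨ε, hε, hball⟩ := Metric.isOpen_iff.mp hI x hx
    refine ⟨x - ε / 2, hball ?_, by linarith⟩
    rw [Real.ball_eq_Ioo]
    constructor <;> linarith
  have hupp {x : ℝ} (hx : x ∈ I) : ∃ y ∈ I, x < y := by
    obtain ⟨ε, hε, hball⟩ := Metric.isOpen_iff.mp hI x hx
    refine ⟨x + ε / 2, hball ?_, by linarith⟩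
    rw [Real.ball_eq_Ioo]
    constructor <;> linarith
  have hmin : min t₀ t ∈ I := by rcases min_choice t₀ t with h | h <;> rwa [h]
  have hmax : max t₀ t ∈ I := by rcases max_choice t₀ t with h | h <;> rwa [h]
  -- Choose a compact interval in `I` with both times in its interior. A C¹ field is only locally
  -- Lipschitz, but it is Lipschitz on the compact union of the two images of this interval.
  obtain ⟨a, haI, ha⟩ := hlow hmin
  obtain ⟨b, hbI, hb⟩ := hupp hmax
  have hsub : Set.Icc a b ⊆ I := hI'.ordConnected.out haI hbI
  have hfc : ContinuousOn f (Set.Icc a b) := fun s hs =>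
    (hf s (hsub hs)).continuousAt.continuousWithinAt
  have hgc : ContinuousOn g (Set.Icc a b) := fun s hs =>
    (hg s (hsub hs)).continuousAt.continuousWithinAt
  obtain ⟨K, hK⟩ := (hv.locallyLipschitz.locallyLipschitzOn
    (s := f '' Set.Icc a b ∪ g '' Set.Icc a b)).exists_lipschitzOnWith_of_compact
    ((isCompact_Icc.image_of_continuousOn hfc).union (isCompact_Icc.image_of_continuousOn hgc))
  have hIoo {s : ℝ} (hs : s ∈ Set.Ioo a b) := Set.Ioo_subset_Icc_self hs
  exact ODE_solution_unique_of_mem_Icc (v := fun _ => v)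
    (s := fun _ => f '' Set.Icc a b ∪ g '' Set.Icc a b) (fun _ _ => hK)
    (t₀ := t₀) ⟨ha.trans_le (min_le_left _ _), (le_max_left _ _).trans_lt hb⟩
    hfc (fun s hs => hf s (hsub (hIoo hs))) (fun s hs => Or.inl ⟨s, hIoo hs, rfl⟩)
    hgc (fun s hs => hg s (hsub (hIoo hs))) (fun s hs => Or.inr ⟨s, hIoo hs, rfl⟩) h₀
    ⟨(ha.trans_le (min_le_right _ _)).le, ((le_max_right _ _).trans_lt hb).le⟩

lemma eqOn_of_second_order {S : E × E → E} (hS : ContDiff ℝ 1 S) {I : Set ℝ}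
    (hI : IsOpen I) (hI' : IsPreconnected I) {f f₁ g g₁ : ℝ → E}
    (hf : ∀ t ∈ I, HasDerivAt f (f₁ t) t) (hf₁ : ∀ t ∈ I, HasDerivAt f₁ (S (f t, f₁ t)) t)
    (hg : ∀ t ∈ I, HasDerivAt g (g₁ t) t) (hg₁ : ∀ t ∈ I, HasDerivAt g₁ (S (g t, g₁ t)) t)
    {t₀ : ℝ} (ht₀ : t₀ ∈ I) (h₀ : f t₀ = g t₀) (h₁ : f₁ t₀ = g₁ t₀) : Set.EqOn f g I := by
  intro t ht
  have := eqOn_of_hasDerivAt_of_contDiff (v := fun p : E × E => (p.2, S p))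
    (contDiff_snd.prodMk hS) hI hI' (f := fun t => (f t, f₁ t)) (g := fun t => (g t, g₁ t))
    (fun t ht => (hf t ht).prodMk (hf₁ t ht)) (fun t ht => (hg t ht).prodMk (hg₁ t ht)) ht₀
    (by simp [h₀, h₁]) ht
  exact congrArg Prod.fst this

variable [FiniteDimensional ℝ E]

lemma tsum_pow_apply_eq_exp (P : E →ₗ[ℝ] E) (b : E) :
    ∑' k : ℕ, ((k.factorial : ℝ)⁻¹) • (P ^ k) b =
      NormedSpace.exp (LinearMap.toContinuousLinearMap P) b := by
  have : CompleteSpace E := FiniteDimensional.complete ℝ E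
  have h := (NormedSpace.exp_series_hasSum_exp' (𝕂 := ℝ)
    (LinearMap.toContinuousLinearMap P)).mapL (ContinuousLinearMap.apply ℝ E b)
  rw [← ContinuousLinearMap.apply_apply (𝕜 := ℝ) b, ← h.tsum_eq]
  refine tsum_congr fun k => ?_
  have hk : ((LinearMap.toContinuousLinearMap P) ^ k) b = (P ^ k) b := by
    induction k with
    | zero => simp
    | succ k ih => rw [pow_succ', pow_succ']; simp [ih]
  simp [hk]

lemma hasDerivAt_tsum_pow_apply (P : E →ₗ[ℝ] E) (b : E) (t : ℝ) :
    HasDerivAt (fun s : ℝ => ∑' k : ℕ, ((k.factorial : ℝ)⁻¹) • ((s • P) ^ k) b)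
      (P (∑' k : ℕ, ((k.factorial : ℝ)⁻¹) • ((t • P) ^ k) b)) t := by
  have : CompleteSpace E := FiniteDimensional.complete ℝ E
  simp only [tsum_pow_apply_eq_exp, map_smul]
  have h := (hasDerivAt_exp_smul_const' (LinearMap.toContinuousLinearMap P) t).clm_apply
    (hasDerivAt_const t b)
  simpa using h

/-- The function s ↦ exp(-sP) w(s) has zero derivative within the interval, hence takes equal values
at the endpoints. -/
lemma eq_tsum_pow_apply_of_hasDerivWithinAt (P : E →ₗ[ℝ] E) {w : ℝ → E} {t : ℝ}
    (hw : ∀ s ∈ Set.uIcc 0 t, HasDerivWithinAt w (P (w s)) (Set.uIcc 0 t) s) :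
    w t = ∑' k : ℕ, ((k.factorial : ℝ)⁻¹) • ((t • P) ^ k) (w 0) := by
  have : CompleteSpace E := FiniteDimensional.complete ℝ E
  set L := LinearMap.toContinuousLinearMap P with hL
  have hu : ∀ s ∈ Set.uIcc 0 t, HasDerivWithinAt
      (fun s : ℝ => NormedSpace.exp (s • (-L)) (w s)) 0 (Set.uIcc 0 t) s := by
    intro s hs
    have h := (hasDerivAt_exp_smul_const (-L) s).hasDerivWithinAt (s := Set.uIcc 0 t)
      |>.clm_apply (hw s hs)
    convert! h using 1
    simp [hL]
  have h1 := Convex.norm_image_sub_le_of_norm_hasDerivWithin_le (C := 0) hu (by simp)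
    (convex_uIcc 0 t) Set.left_mem_uIcc Set.right_mem_uIcc
  rw [zero_mul, norm_le_zero_iff, sub_eq_zero] at h1
  simp only [zero_smul, NormedSpace.exp_zero] at h1
  rw [tsum_pow_apply_eq_exp, map_smul, ← hL]
  change w t = NormedSpace.exp (t • L) (w 0)
  have h2 : w 0 = NormedSpace.exp (t • (-L)) (w t) := h1.symm
  have h3 : NormedSpace.exp (t • L) * NormedSpace.exp (t • (-L)) = 1 := by
    let _ : NormedAlgebra ℚ (E →L[ℝ] E) := NormedAlgebra.restrictScalars ℚ ℝ (E →L[ℝ] E)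
    rw [smul_neg, ← NormedSpace.exp_add_of_commute (Commute.refl _).neg_right, add_neg_cancel,
      NormedSpace.exp_zero]
  rw [h2, ← mul_apply_eq_comp, h3]
  rfl

end ODE

/-! ### The exponential action on matrices -/

section ExpAction

variable {d m : ℕ}

lemma expAction_zero_smul (P : Mat d m →ₗ[ℝ] Mat d m) (b : Mat d m) :
    expAction ((0 : ℝ) • P) b = b := by
  rw [expAction, zero_smul]
  exact (tsum_pow_apply_eq_exp 0 b).trans (by simp)

lemma expAction_transpose {P : Mat d m →ₗ[ℝ] Mat d m} (hP : ∀ w, wᵀ = -w → (P w)ᵀ = -P w)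
    {b : Mat d m} (hb : bᵀ = -b) : (expAction P b)ᵀ = -expAction P b := by
  have hk (k : ℕ) : ((P ^ k) b)ᵀ = -(P ^ k) b := by
    induction k with
    | zero => simpa using hb
    | succ k ih => rw [pow_succ']; exact hP _ ih
  rw [expAction, Matrix.transpose_tsum, ← tsum_neg]
  simp only [Matrix.transpose_smul, hk, smul_neg]

lemma hasDerivAt_expAction (P : Mat d m →ₗ[ℝ] Mat d m) (b : Mat d m) (t : ℝ) :
    HasDerivAt (fun s : ℝ => expAction (s • P) b) (P (expAction (t • P) b)) t :=
  hasDerivAt_tsum_pow_apply P b t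

lemma eq_expAction_of_hasDerivWithinAt (P : Mat d m →ₗ[ℝ] Mat d m) {w : ℝ → Mat d m} {t : ℝ}
    (hw : ∀ s ∈ Set.uIcc 0 t, HasDerivWithinAt w (P (w s)) (Set.uIcc 0 t) s) :
    w t = expAction (t • P) (w 0) :=
  eq_tsum_pow_apply_of_hasDerivWithinAt P hw

end ExpAction

/-! ### Product rule for curves between two one-parameter groups -/

section TwistedCurve

variable {R : Type*} [NormedRing R] [NormedAlgebra ℝ R] [CompleteSpace R]

lemma hasDerivWithinAt_exp_mul_exp (X M N : R) {w : ℝ → R} {w' : R} {s : Set ℝ} {t : ℝ}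
    (hw : HasDerivWithinAt w w' s t) :
    HasDerivWithinAt
      (fun t : ℝ => X * NormedSpace.exp (t • M) * w t * NormedSpace.exp (t • N))
      (X * NormedSpace.exp (t • M) * (M * w t + w' + w t * N) * NormedSpace.exp (t • N)) s t := by
  have h := ((hasDerivAt_mul_exp X M t).hasDerivWithinAt.mul hw).mul
    (hasDerivAt_exp_smul_const' (𝕂 := ℝ) N t).hasDerivWithinAt
  convert! h using 1
  simp only [Pi.mul_apply, mul_add, add_mul, mul_assoc]

end TwistedCurve

/-! ### Twisted curves and the reduction to constant coefficients -/

section Transport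

variable {d m : ℕ}

lemma opP_apply (α : ℝ) (a w : Mat d m) :
    opP (-2 * α) a w = -((a - (1 - 2 * α) • projA a) * w) - w * ((1 - 2 * α) • projA a) -
      leftConn α a w := by
  change (1 / 2 : ℝ) • (⁅w, a⁆ + (1 + -2 * α) • (⁅projA a, w⁆ - ⁅projA w, a⁆)) = _
  rw [leftConn]
  simp only [Ring.lie_def, sub_mul, smul_mul_assoc, mul_smul_comm]
  module

lemma leftConn_self (α : ℝ) (a : Mat d m) :
    (a - (1 - 2 * α) • projA a) * a + a * ((1 - 2 * α) • projA a) + leftConn α a a = 0 := by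
  rw [leftConn]
  simp only [Ring.lie_def, sub_mul, smul_mul_assoc, mul_smul_comm]
  module

lemma opP_transpose (β : ℝ) {a w : Mat d m} (ha : aᵀ = -a) (hw : wᵀ = -w) :
    (opP β a w)ᵀ = -opP β a w := by
  change ((1 / 2 : ℝ) • (⁅w, a⁆ + (1 + β) • (⁅projA a, w⁆ - ⁅projA w, a⁆)))ᵀ =
    -((1 / 2 : ℝ) • (⁅w, a⁆ + (1 + β) • (⁅projA a, w⁆ - ⁅projA w, a⁆)))
  rw [Matrix.transpose_smul, Matrix.transpose_add, Matrix.transpose_smul, Matrix.transpose_sub,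
    lie_transpose_of_skew hw ha, lie_transpose_of_skew (projA_transpose a) hw,
    lie_transpose_of_skew (projA_transpose w) ha]
  module

lemma leftConn_conj (α : ℝ) {Q : Mat d m} (hQ : Q * Qᵀ = 1) (hE : Commute (blockProj d m) Q)
    (v w : Mat d m) :
    leftConn α (Qᵀ * v * Q) (Qᵀ * w * Q) = Qᵀ * leftConn α v w * Q := by
  have hmul (x y : Mat d m) : (Qᵀ * x * Q) * (Qᵀ * y * Q) = Qᵀ * (x * y) * Q := by
    calc _ = Qᵀ * x * (Q * Qᵀ) * y * Q := by noncomm_ring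
      _ = _ := by rw [hQ]; noncomm_ring
  simp only [leftConn, projA_conj hE, Ring.lie_def, hmul]
  simp only [mul_add, add_mul, mul_sub, sub_mul, mul_neg, neg_mul, mul_smul_comm, smul_mul_assoc]

lemma conj_skew {Q w : Mat d m} (hw : wᵀ = -w) : (Qᵀ * w * Q)ᵀ = -(Qᵀ * w * Q) := by
  simp [Matrix.transpose_mul, hw, mul_assoc]

lemma blockProj_commute_projA (a : Mat d m) : Commute (blockProj d m) (projA a) := by
  rw [projA_eq]
  refine Commute.smul_right ?_ _
  set E := blockProj d m
  have hEE : E * E = E := blockProj_mul_self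
  calc E * (E * (a - aᵀ) * E) = (E * E) * (a - aᵀ) * E := by noncomm_ring
    _ = E * (a - aᵀ) * (E * E) := by rw [hEE]
    _ = _ := by noncomm_ring

variable (α : ℝ) {X a : Mat d m}

/-- The curve `X exp(t (a - (1 - 2α) a_𝔞)) w exp(t (1 - 2α) a_𝔞)`. -/
def twist (X a w : Mat d m) (t : ℝ) : Mat d m :=
  X * NormedSpace.exp (t • (a - (1 - 2 * α) • projA a)) * w *
    NormedSpace.exp (t • ((1 - 2 * α) • projA a))

lemma twist_zero (X a w : Mat d m) : twist α X a w 0 = X * w := by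
  simp [twist]

lemma twist_neg (X a w : Mat d m) (t : ℝ) : twist α X a (-w) t = -twist α X a w t := by
  simp [twist]

lemma twist_add (X a v w : Mat d m) (t : ℝ) :
    twist α X a (v + w) t = twist α X a v t + twist α X a w t := by
  simp [twist, mul_add, add_mul]

lemma left_skew (ha : aᵀ = -a) (t : ℝ) :
    (t • (a - (1 - 2 * α) • projA a))ᵀ = -(t • (a - (1 - 2 * α) • projA a)) := by
  rw [Matrix.transpose_smul, Matrix.transpose_sub, Matrix.transpose_smul, projA_transpose, ha]
  module

lemma right_skew (a : Mat d m) (t : ℝ) :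
    (t • ((1 - 2 * α) • projA a))ᵀ = -(t • ((1 - 2 * α) • projA a)) := by
  rw [Matrix.transpose_smul, Matrix.transpose_smul, projA_transpose]
  module

lemma hasDerivWithinAt_twist (X a : Mat d m) {w : ℝ → Mat d m} {w' : Mat d m} {s : Set ℝ} {t : ℝ}
    (hw : HasDerivWithinAt w w' s t) :
    HasDerivWithinAt (fun t => twist α X a (w t) t)
      (twist α X a ((a - (1 - 2 * α) • projA a) * w t + w' + w t * ((1 - 2 * α) • projA a)) t)
      s t :=
  hasDerivWithinAt_exp_mul_exp _ _ _ hw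

lemma twist_one_mem_SO (hX : X ∈ SO d m) (ha : aᵀ = -a) (t : ℝ) : twist α X a 1 t ∈ SO d m := by
  rw [twist, mul_one]
  exact mul_mem_SO (mul_mem_SO hX (exp_mem_SO (left_skew α ha t))) (exp_mem_SO (right_skew α a t))

/-- Rewrites a twist as a left translate from the point of the curve itself: inserting QQᵀ = 1, with
Q the right exponential, exhibits the body velocity QᵀwQ. -/
lemma twist_eq (X a w : Mat d m) (t : ℝ) :
    twist α X a w t = twist α X a 1 t * ((NormedSpace.exp (t • ((1 - 2 * α) • projA a)))ᵀ * w *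
      NormedSpace.exp (t • ((1 - 2 * α) • projA a))) := by
  have hQ := mul_eq_one_comm.mp (exp_transpose_mul_exp (right_skew α a t))
  rw [twist, twist, mul_one]
  set U := X * NormedSpace.exp (t • (a - (1 - 2 * α) • projA a))
  set Q := NormedSpace.exp (t • ((1 - 2 * α) • projA a))
  calc U * w * Q = U * 1 * w * Q := by rw [mul_one]
    _ = _ := by rw [← hQ]; noncomm_ring

lemma christoffel_twist (hX : X ∈ SO d m) (ha : aᵀ = -a) {v w : Mat d m} (hv : vᵀ = -v)
    (hw : wᵀ = -w) (t : ℝ) :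
    christoffel α (twist α X a 1 t) (twist α X a v t) (twist α X a w t) =
      twist α X a (leftConn α v w) t := by
  have hQ := mul_eq_one_comm.mp (exp_transpose_mul_exp (right_skew α a t))
  have hE : Commute (blockProj d m) (NormedSpace.exp (t • ((1 - 2 * α) • projA a))) :=
    (((blockProj_commute_projA a).smul_right _).smul_right _).exp_right
  rw [twist_eq α X a v, twist_eq α X a w, twist_eq α X a (leftConn α v w),
    christoffel_mul α (transpose_mul_self_of_mem_SO (twist_one_mem_SO α hX ha t)) (conj_skew hv)
    (conj_skew hw), leftConn_conj α hQ hE]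

lemma isTangent_twist (hX : X ∈ SO d m) (ha : aᵀ = -a) {w : Mat d m} (hw : wᵀ = -w) (t : ℝ) :
    IsTangent (twist α X a 1 t) (twist α X a w t) := by
  rw [twist_eq α X a w, isTangent_mul_iff (twist_one_mem_SO α hX ha t)]
  exact conj_skew hw

lemma exists_eq_twist (X a v : Mat d m) (t : ℝ) (h : vᵀ = -v) :
    ∃ w : Mat d m, wᵀ = -w ∧ twist α X a 1 t * v = twist α X a w t := by
  set Q := NormedSpace.exp (t • ((1 - 2 * α) • projA a)) with hQdef
  have hQ : Qᵀ * Q = 1 := exp_transpose_mul_exp (right_skew α a t)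
  refine ⟨Q * v * Qᵀ, by simpa using conj_skew (Q := Qᵀ) h, ?_⟩
  rw [twist_eq α X a (Q * v * Qᵀ), ← hQdef]
  congr 1
  calc v = (Qᵀ * Q) * v * (Qᵀ * Q) := by rw [hQ]; simp
    _ = _ := by noncomm_ring

lemma hasDerivAt_twist_one (X a : Mat d m) (t : ℝ) :
    HasDerivAt (twist α X a 1) (twist α X a a t) t := by
  have h := hasDerivWithinAt_twist α X a (hasDerivWithinAt_const t Set.univ (1 : Mat d m))
  rw [mul_one, one_mul, add_zero, sub_add_cancel] at h
  exact h.hasDerivAt Filter.univ_mem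

lemma hasDerivAt_twist_self (X a : Mat d m) (t : ℝ) :
    HasDerivAt (twist α X a a) (-twist α X a (leftConn α a a) t) t := by
  have h := hasDerivWithinAt_twist α X a (hasDerivWithinAt_const t Set.univ a)
  rw [add_zero, eq_neg_of_add_eq_zero_left (leftConn_self α a), twist_neg] at h
  exact h.hasDerivAt Filter.univ_mem

lemma hasDerivWithinAt_twist_expAction (X a b : Mat d m) (s : Set ℝ) (t : ℝ) :
    HasDerivWithinAt (fun t => twist α X a (expAction (t • opP (-2 * α) a) b) t)
      (-twist α X a (leftConn α a (expAction (t • opP (-2 * α) a) b)) t) s t := by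
  have h := hasDerivWithinAt_twist α X a
    (hasDerivAt_expAction (opP (-2 * α) a) b t).hasDerivWithinAt (s := s)
  rw [opP_apply] at h
  rw [← twist_neg]
  convert! h using 2
  abel

lemma exp_smul_neg_mul_exp (M : Mat d m) (t : ℝ) :
    NormedSpace.exp (t • -M) * NormedSpace.exp (t • M) = 1 := by
  rw [smul_neg, ← Matrix.exp_add_of_commute _ _ (Commute.refl (t • M)).neg_left]
  simp

/-- The inverse of `twist`. -/
def untwist (X a v : Mat d m) (t : ℝ) : Mat d m :=
  1 * NormedSpace.exp (t • -(a - (1 - 2 * α) • projA a)) * (Xᵀ * v) *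
    NormedSpace.exp (t • -((1 - 2 * α) • projA a))

lemma untwist_zero (X a v : Mat d m) : untwist α X a v 0 = Xᵀ * v := by
  simp [untwist]

lemma untwist_twist (hX : X ∈ SO d m) (a w : Mat d m) (t : ℝ) :
    untwist α X a (twist α X a w t) t = w := by
  rw [untwist, twist, mul_assoc X, mul_assoc X, transpose_mul_cancel_of_mem_SO hX]
  have hM := exp_smul_neg_mul_exp (a - (1 - 2 * α) • projA a) t
  have hN := mul_eq_one_comm.mp (exp_smul_neg_mul_exp ((1 - 2 * α) • projA a) t)
  set U := NormedSpace.exp (t • (a - (1 - 2 * α) • projA a))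
  set U' := NormedSpace.exp (t • -(a - (1 - 2 * α) • projA a))
  set Q := NormedSpace.exp (t • ((1 - 2 * α) • projA a))
  set Q' := NormedSpace.exp (t • -((1 - 2 * α) • projA a))
  calc 1 * U' * (U * w * Q) * Q' = (U' * U) * w * (Q * Q') := by noncomm_ring
    _ = w := by rw [hM, hN]; simp

lemma twist_mul_right (X a w : Mat d m) (t : ℝ) :
    twist α X a w t * ((1 - 2 * α) • projA a) = twist α X a (w * ((1 - 2 * α) • projA a)) t := by
  have h : Commute ((1 - 2 * α) • projA a)
      (NormedSpace.exp (t • ((1 - 2 * α) • projA a))) :=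
    ((Commute.refl _).smul_right t).exp_right
  rw [twist, twist, mul_assoc, ← h.eq]
  noncomm_ring

lemma mul_transpose_mul_twist (hX : X ∈ SO d m) (a w : Mat d m) (t : ℝ) :
    (a - (1 - 2 * α) • projA a) * (Xᵀ * twist α X a w t) =
      Xᵀ * twist α X a ((a - (1 - 2 * α) • projA a) * w) t := by
  have h : Commute (a - (1 - 2 * α) • projA a)
      (NormedSpace.exp (t • (a - (1 - 2 * α) • projA a))) :=
    ((Commute.refl _).smul_right t).exp_right
  simp only [twist, mul_assoc X]
  rw [transpose_mul_cancel_of_mem_SO hX, transpose_mul_cancel_of_mem_SO hX]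
  set M := a - (1 - 2 * α) • projA a
  set U := NormedSpace.exp (t • M)
  set Q := NormedSpace.exp (t • ((1 - 2 * α) • projA a))
  calc M * (U * w * Q) = (M * U) * w * Q := by noncomm_ring
    _ = U * (M * w) * Q := by rw [h.eq]; noncomm_ring

/-- Untwisting has the same shape as twisting, with base point 1 and negated exponents, so the same
product rule applies. The terms it produces recombine into the twist of P_a w, which untwisting then
removes. -/
lemma hasDerivWithinAt_untwist (hX : X ∈ SO d m) (a : Mat d m) {Δ : ℝ → Mat d m} {w : Mat d m}
    {s : Set ℝ} {t : ℝ} (hΔ : Δ t = twist α X a w t)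
    (hΔ' : HasDerivWithinAt Δ (-twist α X a (leftConn α a w) t) s t) :
    HasDerivWithinAt (fun t => untwist α X a (Δ t) t) (opP (-2 * α) a w) s t := by
  have h : HasDerivWithinAt (fun t => untwist α X a (Δ t) t) _ s t :=
    hasDerivWithinAt_exp_mul_exp 1 (-(a - (1 - 2 * α) • projA a)) (-((1 - 2 * α) • projA a))
      (hΔ'.const_mul Xᵀ)
  convert! h using 1
  have h1 : -(a - (1 - 2 * α) • projA a) * (Xᵀ * Δ t) + Xᵀ * -twist α X a (leftConn α a w) t +
      Xᵀ * Δ t * -((1 - 2 * α) • projA a) = Xᵀ * twist α X a (opP (-2 * α) a w) t := by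
    rw [hΔ, mul_neg, neg_mul, mul_transpose_mul_twist α hX, mul_assoc, mul_neg (twist α X a w t),
      twist_mul_right, ← twist_neg, ← mul_neg, ← mul_neg, ← twist_neg, ← twist_neg, ← mul_add, ← mul_add,
      ← twist_add, ← twist_add, opP_apply]
    congr 2
    abel
  exact (untwist_twist α hX a (opP (-2 * α) a w) t).symm.trans
    (congrArg (fun v => 1 * NormedSpace.exp (t • -(a - (1 - 2 * α) • projA a)) * v *
      NormedSpace.exp (t • -((1 - 2 * α) • projA a))) h1.symm)

end Transport

/-! ### Geodesics and parallel transport for an arbitrary Levi-Civita Γ -/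

section Geodesic

variable {d m : ℕ} {α : ℝ} {Γ : Mat d m → Mat d m → Mat d m → Mat d m} {X a : Mat d m}

lemma isGeodesicOn_twist (hα : α ≠ 0) (hΓ : IsLeviCivita (metric (-1 / 2) α) Γ)
    (hX : X ∈ SO d m) (ha : aᵀ = -a) : IsGeodesicOn Γ Set.univ (twist α X a 1) := by
  have hd : deriv (twist α X a 1) = twist α X a a :=
    funext fun t => (hasDerivAt_twist_one α X a t).deriv
  refine ⟨fun t _ => twist_one_mem_SO α hX ha t,
    fun t _ => (hasDerivAt_twist_one α X a t).differentiableAt, fun t _ => ?_, fun t _ => ?_⟩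
  · rw [hd]
    exact (hasDerivAt_twist_self α X a t).differentiableAt
  · have h := isTangent_twist α hX ha ha t
    rw [hd, hΓ.eq_christoffel hα (twist_one_mem_SO α hX ha t) h h, christoffel_twist α hX ha ha ha]
    exact add_eq_zero_iff_eq_neg.mpr (hasDerivAt_twist_self α X a t).deriv

/-- Differentiate cᵀc = 1, which holds near `t` because `I` is open. -/
lemma isTangent_of_hasDerivAt {I : Set ℝ} (hI : IsOpen I) {c : ℝ → Mat d m}
    (hc : ∀ t ∈ I, c t ∈ SO d m) {t : ℝ} (ht : t ∈ I) {c' : Mat d m} (h : HasDerivAt c c' t) :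
    IsTangent (c t) c' := by
  have h1 := (hasDerivAt_transpose h).mul h
  have h2 : (fun s => (c s)ᵀ) * c =ᶠ[nhds t] fun _ => (1 : Mat d m) := by
    filter_upwards [hI.mem_nhds ht] with s hs
    exact transpose_mul_self_of_mem_SO (hc s hs)
  have h3 := (h1.congr_of_eventuallyEq h2.symm).unique (hasDerivAt_const t (1 : Mat d m))
  rw [isTangent_iff (hc t ht), Matrix.transpose_mul, Matrix.transpose_transpose]
  exact eq_neg_of_add_eq_zero_left h3

/-- `Γ` is determined only on tangent vectors over SO(n). Velocities are tangent, so it may be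
replaced by the explicit formula, to which ODE theory in the ambient space applies. -/
lemma IsGeodesicOn.hasDerivAt_christoffel (hα : α ≠ 0)
    (hΓ : IsLeviCivita (metric (-1 / 2) α) Γ) {I : Set ℝ} (hI : IsOpen I) {c : ℝ → Mat d m}
    (hc : IsGeodesicOn Γ I c) {t : ℝ} (ht : t ∈ I) :
    HasDerivAt (deriv c) (-christoffel α (c t) (deriv c t) (deriv c t)) t := by
  have h1 := isTangent_of_hasDerivAt hI hc.mem ht (hc.differentiable t ht).hasDerivAt
  have h2 := hc.equation t ht
  exact (hc.differentiable_deriv t ht).hasDerivAt.congr_deriv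
    ((eq_neg_of_add_eq_zero_left h2).trans
      (congrArg Neg.neg (hΓ.eq_christoffel hα (hc.mem t ht) h1 h1)))

lemma IsGeodesicOn.eqOn (hα : α ≠ 0) (hΓ : IsLeviCivita (metric (-1 / 2) α) Γ) {I : Set ℝ}
    (hI : IsOpen I) (hI' : IsPreconnected I) {c γ : ℝ → Mat d m} (hc : IsGeodesicOn Γ I c)
    (hγ : IsGeodesicOn Γ I γ) {t₀ : ℝ} (ht₀ : t₀ ∈ I) (h₀ : c t₀ = γ t₀)
    (h₁ : deriv c t₀ = deriv γ t₀) : Set.EqOn c γ I :=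
  eqOn_of_second_order (S := fun p : Mat d m × Mat d m => -christoffel α p.1 p.2 p.2)
    (contDiff_christoffel α contDiff_fst contDiff_snd contDiff_snd).neg hI hI'
    (fun t ht => (hc.differentiable t ht).hasDerivAt)
    (fun _ ht => hc.hasDerivAt_christoffel hα hΓ hI ht)
    (fun t ht => (hγ.differentiable t ht).hasDerivAt)
    (fun _ ht => hγ.hasDerivAt_christoffel hα hΓ hI ht) ht₀ h₀ h₁

lemma isParallelTransport_twist_iff (hα : α ≠ 0) (hΓ : IsLeviCivita (metric (-1 / 2) α) Γ)
    (hX : X ∈ SO d m) (ha : aᵀ = -a) {b : Mat d m} (hb : bᵀ = -b) (t : ℝ) (τ : Mat d m) :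
    IsParallelTransport Γ (twist α X a 1) t (X * b) τ ↔
      τ = twist α X a (expAction (t • opP (-2 * α) a) b) t := by
  have hd (s : ℝ) : deriv (twist α X a 1) s = twist α X a a s :=
    (hasDerivAt_twist_one α X a s).deriv
  have hΓt (s : ℝ) {w : Mat d m} (hw : wᵀ = -w) :
      Γ (twist α X a 1 s) (deriv (twist α X a 1) s) (twist α X a w s) =
        twist α X a (leftConn α a w) s := by
    rw [hd, hΓ.eq_christoffel hα (twist_one_mem_SO α hX ha s) (isTangent_twist α hX ha ha s)
      (isTangent_twist α hX ha hw s), christoffel_twist α hX ha ha hw]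
  constructor
  · rintro ⟨Δ, h0, rfl, hΔ⟩
    -- Tangency writes `Δ s` as a twist of some skew `w`, which is what allows `Γ` to be evaluated
    -- on it.
    have htw : ∀ s ∈ Set.uIcc 0 t, ∃ w : Mat d m, wᵀ = -w ∧ Δ s = twist α X a w s := by
      intro s hs
      obtain ⟨v, hv, hvΔ⟩ :=
        (isTangent_iff_exists (twist_one_mem_SO α hX ha s) _).mp (hΔ s hs).1
      obtain ⟨w, hw, hwv⟩ := exists_eq_twist α X a v s hv
      exact ⟨w, hw, hvΔ.trans hwv⟩
    have hun : ∀ s ∈ Set.uIcc 0 t, HasDerivWithinAt (fun s => untwist α X a (Δ s) s)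
        (opP (-2 * α) a (untwist α X a (Δ s) s)) (Set.uIcc 0 t) s := by
      intro s hs
      obtain ⟨w, hw, hwΔ⟩ := htw s hs
      have h2 := (hΔ s hs).2
      rw [hwΔ, hΓt s hw] at h2
      have h3 : untwist α X a (Δ s) s = w := by rw [hwΔ, untwist_twist α hX]
      rw [h3]
      exact hasDerivWithinAt_untwist α hX a hwΔ h2
    have h4 := eq_expAction_of_hasDerivWithinAt _ hun
    obtain ⟨w, hw, hwΔ⟩ := htw t Set.right_mem_uIcc
    simp only [h0, untwist_zero, transpose_mul_cancel_of_mem_SO hX] at h4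
    rw [hwΔ, untwist_twist α hX] at h4
    rw [hwΔ, h4]
  · rintro rfl
    refine ⟨fun s => twist α X a (expAction (s • opP (-2 * α) a) b) s, ?_, rfl, fun s _ => ?_⟩
    · change twist α X a (expAction ((0 : ℝ) • opP (-2 * α) a) b) 0 = X * b
      rw [expAction_zero_smul, twist_zero]
    · have hw : (expAction (s • opP (-2 * α) a) b)ᵀ = -expAction (s • opP (-2 * α) a) b := by
        refine expAction_transpose (fun w hw => ?_) hb
        exact smul_transpose_of_skew (opP_transpose _ ha hw) s
      refine ⟨isTangent_twist α hX ha hw s, ?_⟩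
      rw [hΓt s hw]
      exact hasDerivWithinAt_twist_expAction α X a b _ s

end Geodesic

/-! ### Translation to block matrices -/

section Blocks

variable {d m : ℕ}

lemma smul_projA_skewBlocks {A : Matrix (Fin d) (Fin d) ℝ} (hA : Aᵀ = -A)
    (B : Matrix (Fin m) (Fin d) ℝ) (C : Matrix (Fin m) (Fin m) ℝ) (c : ℝ) :
    c • projA (skewBlocks A B C) = Matrix.fromBlocks (c • A) 0 0 0 := by
  rw [projA_skewBlocks hA, Matrix.fromBlocks_smul]
  simp

/-- Explains the block 2αA of the geodesic formula: it is A - (1 - 2α)A. -/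
lemma skewBlocks_sub_smul_projA {A : Matrix (Fin d) (Fin d) ℝ} (hA : Aᵀ = -A)
    (B : Matrix (Fin m) (Fin d) ℝ) (C : Matrix (Fin m) (Fin m) ℝ) (α : ℝ) :
    skewBlocks A B C - (1 - 2 * α) • projA (skewBlocks A B C) = skewBlocks ((2 * α) • A) B C := by
  rw [smul_projA_skewBlocks hA, skewBlocks, skewBlocks, sub_eq_add_neg, Matrix.fromBlocks_neg,
    Matrix.fromBlocks_add]
  congr 1
  · module
  all_goals simp

lemma lie_projA_skewBlocks {A₁ A₂ : Matrix (Fin d) (Fin d) ℝ} (hA₁ : A₁ᵀ = -A₁) (hA₂ : A₂ᵀ = -A₂)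
    (B₁ B₂ : Matrix (Fin m) (Fin d) ℝ) (C₁ C₂ : Matrix (Fin m) (Fin m) ℝ) :
    ⁅projA (skewBlocks A₁ B₁ C₁), skewBlocks A₂ B₂ C₂⁆ +
        ⁅projA (skewBlocks A₂ B₂ C₂), skewBlocks A₁ B₁ C₁⁆ =
      Matrix.fromBlocks 0 (-(A₁ * B₂ᵀ) - A₂ * B₁ᵀ) (-(B₂ * A₁) - B₁ * A₂) 0 := by
  rw [projA_skewBlocks hA₁, projA_skewBlocks hA₂, Ring.lie_def, Ring.lie_def, skewBlocks,
    skewBlocks]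
  simp only [Matrix.fromBlocks_multiply, sub_eq_add_neg, Matrix.fromBlocks_neg,
    Matrix.fromBlocks_add]
  congr 1 <;> simp

lemma geodesicSO_eq_twist {A : Matrix (Fin d) (Fin d) ℝ} (hA : Aᵀ = -A)
    (B : Matrix (Fin m) (Fin d) ℝ) (C : Matrix (Fin m) (Fin m) ℝ) (α : ℝ) (X : Mat d m) :
    geodesicSO α X A B C = twist α X (skewBlocks A B C) 1 := by
  funext t
  rw [twist, skewBlocks_sub_smul_projA hA, smul_projA_skewBlocks hA, mul_one, geodesicSO]

lemma trace_projA_mul_projA {A₁ A₂ : Matrix (Fin d) (Fin d) ℝ} (hA₁ : A₁ᵀ = -A₁)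
    (hA₂ : A₂ᵀ = -A₂) (B₁ B₂ : Matrix (Fin m) (Fin d) ℝ) (C₁ C₂ : Matrix (Fin m) (Fin m) ℝ) :
    (projA (skewBlocks A₁ B₁ C₁) * projA (skewBlocks A₂ B₂ C₂)).trace = (A₁ * A₂).trace := by
  rw [projA_skewBlocks hA₁, projA_skewBlocks hA₂, Matrix.fromBlocks_multiply]
  simp [Matrix.trace, Fintype.sum_sum_type]

lemma metric_mul {X : Mat d m} (hX : X ∈ SO d m) (α : ℝ) {a b : Mat d m} (ha : aᵀ = -a) :
    metric (-1 / 2) α X (X * a) (X * b) =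
      1 / 2 * ((X * a)ᵀ * (X * b)).trace - (α - 1 / 2) * (projA a * projA b).trace := by
  rw [metric, inv_eq_transpose_of_mem_SO hX, transpose_mul_cancel_of_mem_SO hX,
    transpose_mul_cancel_of_mem_SO hX, algForm, Matrix.transpose_mul, mul_assoc,
    transpose_mul_cancel_of_mem_SO hX, ha, neg_mul, Matrix.trace_neg, Matrix.trace_mul_comm b,
    Matrix.trace_mul_comm (projA b)]
  ring

end Blocks

end DeformedSO

end

/-! ### The main theorem -/

theorem mainTheorem6 (d m : ℕ) (α : ℝ) (hα : α ≠ 0) :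
    (∃ Γ, DeformedSO.IsLeviCivita (d := d) (m := m) (DeformedSO.metric (-1 / 2) α) Γ) ∧
    ∀ Γ, DeformedSO.IsLeviCivita (d := d) (m := m) (DeformedSO.metric (-1 / 2) α) Γ →
    ∀ X ∈ DeformedSO.SO d m,
    ∀ (A₁ A₂ : Matrix (Fin d) (Fin d) ℝ) (B₁ B₂ : Matrix (Fin m) (Fin d) ℝ)
      (C₁ C₂ : Matrix (Fin m) (Fin m) ℝ),
    A₁ ∈ LieAlgebra.Orthogonal.so (Fin d) ℝ → A₂ ∈ LieAlgebra.Orthogonal.so (Fin d) ℝ →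
    C₁ ∈ LieAlgebra.Orthogonal.so (Fin m) ℝ → C₂ ∈ LieAlgebra.Orthogonal.so (Fin m) ℝ →
    ∀ ξ η : DeformedSO.Mat d m,
    ξ = X * DeformedSO.skewBlocks A₁ B₁ C₁ → η = X * DeformedSO.skewBlocks A₂ B₂ C₂ →
    -- the metric
    (DeformedSO.metric (-1 / 2) α X ξ η =
        1 / 2 * (ξᵀ * η).trace +
          (α - 1 / 2) * (DeformedSO.projA (ξᵀ * X) * DeformedSO.projA (Xᵀ * η)).trace ∧
      DeformedSO.metric (-1 / 2) α X ξ η =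
        1 / 2 * (ξᵀ * η).trace + (α - 1 / 2) * (A₁ᵀ * A₂).trace) ∧
    -- the Christoffel function
    (Γ X ξ η =
        (1 / 2 : ℝ) • (X * (ξᵀ * η + ηᵀ * ξ)) +
          ((1 - 2 * α) / 2) • (X * (⁅DeformedSO.projA (Xᵀ * ξ), Xᵀ * η⁆ +
            ⁅DeformedSO.projA (Xᵀ * η), Xᵀ * ξ⁆)) ∧
      Γ X ξ η =
        (1 / 2 : ℝ) • (X * (ξᵀ * η + ηᵀ * ξ)) +
          ((1 - 2 * α) / 2) • (X * Matrix.fromBlocks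
            0 (-(A₁ * B₂ᵀ) - A₂ * B₁ᵀ) (-(B₂ * A₁) - B₁ * A₂) 0)) ∧
    -- the geodesic
    (DeformedSO.IsGeodesicOn Γ Set.univ (DeformedSO.geodesicSO α X A₁ B₁ C₁) ∧
      DeformedSO.geodesicSO α X A₁ B₁ C₁ 0 = X ∧
      deriv (DeformedSO.geodesicSO α X A₁ B₁ C₁) 0 = ξ ∧
      ∀ (I : Set ℝ) (c : ℝ → DeformedSO.Mat d m), IsOpen I → IsPreconnected I → 0 ∈ I →
        DeformedSO.IsGeodesicOn Γ I c → c 0 = X → deriv c 0 = ξ →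
        ∀ t ∈ I, c t = DeformedSO.geodesicSO α X A₁ B₁ C₁ t) ∧
    -- parallel transport along the geodesic
    ∀ (t : ℝ) (τ : DeformedSO.Mat d m),
      DeformedSO.IsParallelTransport Γ (DeformedSO.geodesicSO α X A₁ B₁ C₁) t η τ ↔
      τ = X * NormedSpace.exp (t • DeformedSO.skewBlocks ((2 * α) • A₁) B₁ C₁) *
        DeformedSO.expAction (t • DeformedSO.opP (-2 * α) (Xᵀ * ξ)) (Xᵀ * η) *
        NormedSpace.exp
          (t • (Matrix.fromBlocks ((1 - 2 * α) • A₁) 0 0 0 : DeformedSO.Mat d m)) := by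
  refine ⟨⟨_, DeformedSO.isLeviCivita_christoffel α⟩, ?_⟩
  rintro Γ hΓ X hX A₁ A₂ B₁ B₂ C₁ C₂ hA₁ hA₂ hC₁ hC₂ ξ η rfl rfl
  rw [LieAlgebra.Orthogonal.mem_so] at hA₁ hA₂ hC₁ hC₂
  have ha := DeformedSO.skewBlocks_transpose hA₁ B₁ hC₁
  have hb := DeformedSO.skewBlocks_transpose hA₂ B₂ hC₂
  have hlie := DeformedSO.lie_projA_skewBlocks hA₁ hA₂ B₁ B₂ C₁ C₂
  have htrace := DeformedSO.trace_projA_mul_projA hA₁ hA₂ B₁ B₂ C₁ C₂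
  -- Replaces the block exponents by M and N, so that the geodesic and transport claims become the
  -- statements about `twist`.
  rw [DeformedSO.geodesicSO_eq_twist hA₁, ← DeformedSO.skewBlocks_sub_smul_projA hA₁,
    ← DeformedSO.smul_projA_skewBlocks hA₁ B₁ C₁]
  have hξX : (X * DeformedSO.skewBlocks A₁ B₁ C₁)ᵀ * X = (DeformedSO.skewBlocks A₁ B₁ C₁)ᵀ := by
    rw [Matrix.transpose_mul, mul_assoc, DeformedSO.transpose_mul_self_of_mem_SO hX, mul_one]
  have hmetric := DeformedSO.metric_mul hX α (b := DeformedSO.skewBlocks A₂ B₂ C₂) ha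
  have hconn := hΓ.eq_christoffel hα hX ((DeformedSO.isTangent_mul_iff hX _).mpr ha)
    ((DeformedSO.isTangent_mul_iff hX _).mpr hb)
  have hgeo := DeformedSO.isGeodesicOn_twist hα hΓ hX ha
  have hzero := (DeformedSO.twist_zero α X (DeformedSO.skewBlocks A₁ B₁ C₁) 1).trans (mul_one X)
  have hderiv := (DeformedSO.hasDerivAt_twist_one α X (DeformedSO.skewBlocks A₁ B₁ C₁) 0).deriv.trans
    (DeformedSO.twist_zero α X _ _)
  refine ⟨⟨?_, ?_⟩, ⟨hconn, ?_⟩, ⟨hgeo, hzero, hderiv, ?_⟩, ?_⟩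
  · rw [hmetric, hξX, DeformedSO.projA_transpose_arg, DeformedSO.transpose_mul_cancel_of_mem_SO hX,
      neg_mul, Matrix.trace_neg]
    ring
  · rw [hmetric, htrace, hA₁, neg_mul, Matrix.trace_neg]
    ring
  · rw [hconn, DeformedSO.christoffel, DeformedSO.transpose_mul_cancel_of_mem_SO hX,
      DeformedSO.transpose_mul_cancel_of_mem_SO hX, hlie]
  · intro I c hI hI' h0 hc hc0 hc1
    have hgeoI : DeformedSO.IsGeodesicOn Γ I
        (DeformedSO.twist α X (DeformedSO.skewBlocks A₁ B₁ C₁) 1) :=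
      ⟨fun t _ => hgeo.mem t trivial, fun t _ => hgeo.differentiable t trivial,
        fun t _ => hgeo.differentiable_deriv t trivial, fun t _ => hgeo.equation t trivial⟩
    exact hc.eqOn hα hΓ hI hI' hgeoI h0 (hc0.trans hzero.symm) (hc1.trans hderiv.symm)
  · intro t τ
    rw [DeformedSO.isParallelTransport_twist_iff hα hΓ hX ha hb,
      DeformedSO.transpose_mul_cancel_of_mem_SO hX, DeformedSO.transpose_mul_cancel_of_mem_SO hX,
      DeformedSO.twist]
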